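/- Let $\mathbb K$ be an algebraically closed field, let $E\in\mathbb K[X_1,X_2,X_3]$ be an irreducible form and $C=V(E)\subset\mathbb P^2$. Let $d=2k$, and let $u_1,u_2,u_3\in\mathbb K[T_1,T_2]$ be forms of degree $d$ without common factors, defining a map $\phi=(u_1:u_2:u_3)\colon\mathbb P^1\to C$. Suppose that $\phi$ is parameterizable by conics, that is, there are quadratic forms $F_1,F_2\in\mathbb K[X_1,X_2,X_3]$ without common factors such that $\psi=(F_1:F_2)\colon C\dashrightarrow\mathbb P^1$ is inverse to $\phi$ as a rational map, and that $\phi$ is not parameterizable by lines, that is, no pair of linear forms without common factors has this property. Let $R=\mathbb K[T_1,T_2]$, $I=\langle u_1,u_2,u_3\rangle\subset R$, and let $\mathcal K$ be the kernel of the morphism of $R$-algebras $R[X_1,X_2,X_3]\to \mathrm{Rees}(I)=R[IZ]$, $X_i\mapsto u_iZ$. Denote by $\mathcal K_{i,j}$ the space of its bihomogeneous elements of degree $i$ in $T=(T_1,T_2)$ and $j$ in $X=(X_1,X_2,X_3)$ (together with $0$). Identify a syzygy $(a_1,a_2,a_3)$ of $(u_1,u_2,u_3)$ with $a_1X_1+a_2X_2+a_3X_3$.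 A $\mu$-basis is an $R$-basis of the syzygy module consisting of an element $p$ of $T$-degree $\mu$ and an element $q$ of $T$-degree $d-\mu$, where $0\le\mu\le d/2$. Given $Q\in\mathcal K_{k-1,2}$ that is not a multiple of $T_1F_2(X)-T_2F_1(X)$, a chain from $Q$ is a sequence $P_{k-1},\dots,P_0$ in $\mathbb K[T,X]$ such that $P_{k-1}=Q$ and, for $j=k-2,\dots,0$, one has $P_{j+1}=A\,T_1+B\,T_2$ and $P_j=A\,F_1(X)+B\,F_2(X)$ for some $A,B$ bihomogeneous of bidegree $(j,2k-2(j+1))$, chosen in any way. Then: 1. There is a $\mu$-basis with $\mu=k$, and every $\mu$-basis has $\mu=k$; write it $p_{k,1},q_{k,1}$. 2. There is a $Q$ as above with a chain from $Q$ such that $P_0=E$; and from every such $Q$ there is a chain. 3. For every $\mu$-basis $p_{k,1},q_{k,1}$, every such $Q$ and every chain from $Q$: each $P_j$ is bihomogeneous of bidegree $(j,2k-2j)$; $P_0=cE$ for some $c\in\mathbb K\setminus\{0\}$; and $$J=\{T_1F_2(X)-T_2F_1(X),\;p_{k,1},\;q_{k,1},\;P_{k-1},\dots,P_0\}$$ is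 a minimal set of generators of $\mathcal K$ (it generates $\mathcal K$ and no proper subset of it does), with exactly $k+3$ elements. -/

import Mathlib

open scoped LinearAlgebra.Projectivization

noncomputable section

namespace ConicCurve

/-- `K[T₁, T₂]`. -/
abbrev TPoly (K : Type*) [Field K] := MvPolynomial (Fin 2) K

/-- `K[X₁, X₂, X₃]`. -/
abbrev XPoly (K : Type*) [Field K] := MvPolynomial (Fin 3) K

/-- `K[T][X] = K[T₁, T₂][X₁, X₂, X₃]`. -/
abbrev TXPoly (K : Type*) [Field K] := MvPolynomial (Fin 3) (TPoly K)

/-- The inclusion `K[X] → K[T][X]`. -/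
def inX {K : Type*} [Field K] : XPoly K →+* TXPoly K := MvPolynomial.map MvPolynomial.C

/-- The variable `T_i`, seen in `K[T][X]`. -/
def T {K : Type*} [Field K] (i : Fin 2) : TXPoly K := MvPolynomial.C (MvPolynomial.X i)

/-- The polynomials `f i` have no common factor, except for units. -/
def NoCommonFactor {K σ ι : Type*} [Field K] (f : ι → MvPolynomial σ K) : Prop :=
  ∀ g : MvPolynomial σ K, (∀ i, g ∣ f i) → IsUnit g

/-- The zero locus in the projective plane of a form `E`. -/
def curve {K : Type*} [Field K] (E : XPoly K) : Set (ℙ K (Fin 3 → K)) :=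
  {x | MvPolynomial.eval x.rep E = 0}

/-- The rational map given by a family `f` of forms of the same degree is defined at the point `x`
by these forms, and its value there is the point `y`. -/
def MapsTo {K σ ι : Type*} [Field K] (f : ι → MvPolynomial σ K)
    (x : ℙ K (σ → K)) (y : ℙ K (ι → K)) : Prop :=
  ∃ h : (fun i => MvPolynomial.eval x.rep (f i)) ≠ 0, Projectivization.mk K _ h = y

/-- The curve `C = V(E)` is parameterizable by the pair `F` of forms of degree `n` without common
factors, and the triple `u` of forms of degree `d` without common factors is the proper
parameterization induced by `F`: the map `φ = (u₁ : u₂ : u₃)` sends the projective line to `C`, and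
it is inverse, as a rational map, to `ψ = (F₁ : F₂)`. "Almost all" points of the line, or of an
irreducible curve, are all points with finitely many exceptions. -/
structure IsParameterizedBy {K : Type*} [Field K] (E : XPoly K) (n : ℕ) (F : Fin 2 → XPoly K)
    (d : ℕ) (u : Fin 3 → TPoly K) : Prop where
  F_homogeneous : ∀ i, (F i).IsHomogeneous n
  F_noCommonFactor : NoCommonFactor F
  u_homogeneous : ∀ i, (u i).IsHomogeneous d
  u_noCommonFactor : NoCommonFactor u
  maps_into : ∀ t x, MapsTo u t x → x ∈ curve E
  /-- `ψ ∘ φ = id` for almost all points of the projective line. -/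
  psi_phi : {t | ¬ ∃ x, MapsTo u t x ∧ MapsTo F x t}.Finite
  /-- `φ ∘ ψ = id` for almost all points of `C`. -/
  phi_psi : {x | x ∈ curve E ∧ ¬ ∃ t, MapsTo F x t ∧ MapsTo u t x}.Finite

/-- The ideal `I = ⟨u₁, u₂, u₃⟩` of `K[T]`. -/
def paramIdeal {K : Type*} [Field K] (u : Fin 3 → TPoly K) : Ideal (TPoly K) :=
  Ideal.span (Set.range u)

theorem monomial_mem_rees {K : Type*} [Field K] (u : Fin 3 → TPoly K) (i : Fin 3) :
    Polynomial.monomial 1 (u i) ∈ reesAlgebra (paramIdeal u) :=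
  reesAlgebra.monomial_mem.mpr (by
    rw [pow_one]
    exact Ideal.subset_span (Set.mem_range_self i))

/-- The morphism of `K[T]`-algebras `K[T][X] → Rees(I) ⊆ K[T][Z]`, `X_i ↦ u_i Z`. -/
def reesMap {K : Type*} [Field K] (u : Fin 3 → TPoly K) :
    TXPoly K →ₐ[TPoly K] reesAlgebra (paramIdeal u) :=
  MvPolynomial.aeval fun i => ⟨Polynomial.monomial 1 (u i), monomial_mem_rees u i⟩

/-- The defining ideal of the Rees algebra of `I` (the moving curve ideal). -/
def movingCurveIdeal {K : Type*} [Field K] (u : Fin 3 → TPoly K) : Ideal (TXPoly K) :=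
  RingHom.ker (reesMap u)

/-- `P` is zero or bihomogeneous of degree `i` in `T` and `j` in `X`. -/
def IsBihomogeneous {K : Type*} [Field K] (P : TXPoly K) (i j : ℕ) : Prop :=
  P.IsHomogeneous j ∧ ∀ m, (P.coeff m).IsHomogeneous i

/-- The first module of syzygies of `(u₁, u₂, u₃)`. -/
def syz {K : Type*} [Field K] (u : Fin 3 → TPoly K) : Submodule (TPoly K) (Fin 3 → TPoly K) :=
  LinearMap.ker (Fintype.linearCombination (TPoly K) u)

/-- The homogeneous syzygies `a`, of degree `μ ≤ d / 2`, and `b`, of degree `d - μ`, are a basis of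
the syzygy module. -/
structure IsMuBasis {K : Type*} [Field K] (u : Fin 3 → TPoly K) (d μ : ℕ)
    (a b : Fin 3 → TPoly K) : Prop where
  two_mul_le : 2 * μ ≤ d
  a_homogeneous : ∀ i, (a i).IsHomogeneous μ
  b_homogeneous : ∀ i, (b i).IsHomogeneous (d - μ)
  linearIndependent : LinearIndependent (TPoly K) ![a, b]
  span_eq : Submodule.span (TPoly K) {a, b} = syz u

/-- The moving line `a₁ X₁ + a₂ X₂ + a₃ X₃` of a triple `a`. -/
def movingLine {K : Type*} [Field K] (a : Fin 3 → TPoly K) : TXPoly K :=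
  ∑ i, MvPolynomial.C (a i) * MvPolynomial.X i

/-- `T₁ F₂(X) - T₂ F₁(X)`. -/
def pencil {K : Type*} [Field K] (F : Fin 2 → XPoly K) : TXPoly K :=
  T 0 * inX (F 1) - T 1 * inX (F 0)

/-- `Q` is a moving conic of bidegree `(k - 1, 2)` that follows `u` and is not a multiple of
`T₁ F₂ - T₂ F₁`. -/
def IsExtraConic {K : Type*} [Field K] (u : Fin 3 → TPoly K) (F : Fin 2 → XPoly K) (k : ℕ)
    (Q : TXPoly K) : Prop :=
  Q ∈ movingCurveIdeal u ∧ IsBihomogeneous Q (k - 1) 2 ∧ Q ∉ Ideal.span {pencil F}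

/-- `P_{k-1} = Q` and, going down from `P_{j+1}` to `P_j`, one writes `P_{j+1} = A T₁ + B T₂` with
bihomogeneous `A`, `B` of bidegree `(j, 2k - 2(j + 1))`, in any way, and sets
`P_j = A F₁ + B F₂`. Only the values `P j` with `j < k` matter. -/
def IsChainFrom {K : Type*} [Field K] (F : Fin 2 → XPoly K) (k : ℕ) (Q : TXPoly K)
    (P : ℕ → TXPoly K) : Prop :=
  P (k - 1) = Q ∧
  ∀ j, j + 1 < k → ∃ A B : TXPoly K,
    IsBihomogeneous A j (2 * k - 2 * (j + 1)) ∧ IsBihomogeneous B j (2 * k - 2 * (j + 1)) ∧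
    P (j + 1) = A * T 0 + B * T 1 ∧ P j = A * inX (F 0) + B * inX (F 1)

/-- `J` generates the ideal `I` and no proper subset of `J` does. -/
def IsMinimalGeneratingSet {A : Type*} [CommRing A] (J : Set A) (I : Ideal A) : Prop :=
  Ideal.span J = I ∧ ∀ J' : Set A, J' ⊂ J → Ideal.span J' ≠ I

end ConicCurve

end

noncomputable section

namespace ConicCurve

open MvPolynomial Module

/-! ### Forms -/

/-! Write W(F, X) for the result of T ↦ F(X) and W(T, u) for that of X ↦ u(T). Since ψ inverts φ,
F_i(u) = T_i G with a nonzero form G. Hence, for W of T-degree i, putting X = u in W(F, X) gives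
W(T, u) G^i (`aeval_substT`). So W of bidegree (i, j) follows u exactly when the form W(F, X), of
degree 2i + j, vanishes on the image of u. As F₁ and F₂ are coprime, W(F, X) = 0 only for multiples
of the pencil T₁F₂ - T₂F₁ (`pencil_dvd_of_substT_eq_zero`).

A lower bound for the space of forms restricted to the curve (`finrank_add_le`) shows that a nonzero
form vanishing on the image of u has degree at least d (`le_degree_of_vanishes`) and is divisible by
E (`dvd_of_vanishes`). Hence there are no nonzero syzygies of degree below k. Linear algebra gives
two independent ones of degree k, and these are a basis because their cross product is a constant
multiple of u. For d = 2 a syzygy of degree 1 would yield an inverse by lines; so k ≥ 2, and many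
lemmas write `k + 2` for the k of the theorem.

Another count gives a moving conic Q outside the pencil. Then Q(F, X) is nonzero of degree 2k and
vanishes on the curve, so E has degree 2k and Q(F, X) = cE. A step of a chain replaces T by F in
part of the polynomial and so leaves P(F, X) unchanged: all P_j(F, X) equal cE, in particular P_0 =
cE.

Generation depends on the T-degree i of W. If i < k, then W(F, X) = zE, and W - (z/c) P_i is a
multiple of the pencil. If i ≥ k, write W = A T₁ + B T₂; then A(T, u) = T₂ g and B(T, u) = -T₁ g.
Changing (A, B) by (T₂ D, -T₁ D) removes g when g = D(T, u). For i > k this is possible because ⟨u₁,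
u₂, u₃⟩ contains all forms of the relevant degree; for i = k two dimensions are missing, and p and q
supply them (`exists_combination_add_eq`). Minimality follows by comparing bidegrees. -/

/-- The exponents of degree `n`. -/
def exponents (s n : ℕ) : Finset (Fin s →₀ ℕ) := Finset.finsuppAntidiag Finset.univ n

theorem mem_exponents {s n : ℕ} {m : Fin s →₀ ℕ} : m ∈ exponents s n ↔ m.degree = n := by
  simp [exponents, Finset.mem_finsuppAntidiag, Finsupp.degree_eq_sum]

theorem card_exponents (s n : ℕ) : (exponents (s + 1) n).card = (n + s).choose s := by
  rw [exponents, Finset.card_finsuppAntidiag_nat_eq_choose]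
  simp only [Finset.card_univ, Fintype.card_fin, Nat.add_right_comm s 1 n, Nat.add_sub_cancel]
  rw [add_comm s n, Nat.choose_symm_add]

/-- A form of degree `n` is given by its coefficients. -/
def formsEquiv (K : Type*) [Field K] (s n : ℕ) :
    homogeneousSubmodule (Fin s) K n ≃ₗ[K] (exponents s n → K) where
  toFun f m := coeff m.1 f.1
  map_add' f g := by ext m; simp
  map_smul' c f := by ext m; simp
  invFun g := ⟨∑ m, monomial m.1 (g m), by
    refine Submodule.sum_mem _ fun m _ => isHomogeneous_monomial _ (mem_exponents.1 m.2)⟩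
  left_inv f := by
    ext m
    simp only [coeff_sum, coeff_monomial]
    by_cases hm : m ∈ exponents s n
    · rw [Finset.sum_eq_single ⟨m, hm⟩]
      · simp
      · intro b _ hb
        rw [if_neg]
        rintro rfl
        exact hb rfl
      · simp
    · rw [(show f.1.IsHomogeneous n from f.2).coeff_eq_zero fun h => hm (mem_exponents.2 h)]
      refine Finset.sum_eq_zero fun b _ => if_neg ?_
      rintro rfl
      exact hm b.2
  right_inv g := by
    ext m
    simp only [coeff_sum, coeff_monomial]
    rw [Finset.sum_eq_single m]
    · simp
    · intro b _ hb
      exact if_neg fun h => hb (Subtype.ext h)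
    · simp

instance finiteDimensional_forms (K : Type*) [Field K] (s n : ℕ) :
    FiniteDimensional K (homogeneousSubmodule (Fin s) K n) :=
  Module.Finite.equiv (formsEquiv K s n).symm

theorem finrank_forms (K : Type*) [Field K] (s n : ℕ) :
    finrank K (homogeneousSubmodule (Fin (s + 1)) K n) = (n + s).choose s := by
  rw [(formsEquiv K (s + 1) n).finrank_eq, finrank_fintype_fun_eq_card, Fintype.card_coe,
    card_exponents]

theorem homogeneousComponent_mul_left {K σ : Type*} [CommRing K] {f g : MvPolynomial σ K} {m : ℕ}
    (hf : f.IsHomogeneous m) (n : ℕ) :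
    homogeneousComponent (m + n) (f * g) = f * homogeneousComponent n g := by
  classical
  let := gradedAlgebra (σ := σ) (R := K)
  have h := DirectSum.coe_decompose_mul_add_of_left_mem (homogeneousSubmodule σ K)
    (a := f) (b := g) (i := m) (j := n) hf
  rwa [← decomposition.decompose'_apply, ← decomposition.decompose'_apply]

theorem homogeneousComponent_mul_of_lt {K σ : Type*} [CommRing K] {f g : MvPolynomial σ K}
    {m n : ℕ} (hf : f.IsHomogeneous m) (h : n < m) : homogeneousComponent n (f * g) = 0 := by
  classical
  let := gradedAlgebra (σ := σ) (R := K)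
  rw [← decomposition.decompose'_apply]
  exact DirectSum.coe_decompose_mul_of_left_mem_of_not_le (homogeneousSubmodule σ K)
    (a := f) (b := g) (i := m) (n := n) hf h.not_ge

/-- The cofactor of a form in a form can be chosen to be a form. -/
theorem exists_form_of_dvd {K σ : Type*} [CommRing K] {f h : MvPolynomial σ K} {m n : ℕ}
    (hf : f.IsHomogeneous m) (hh : h.IsHomogeneous (m + n)) (hfh : f ∣ h) :
    ∃ g : MvPolynomial σ K, g.IsHomogeneous n ∧ h = f * g := by
  obtain ⟨g, rfl⟩ := hfh
  exact ⟨_, homogeneousComponent_isHomogeneous n g, by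
    rw [← homogeneousComponent_mul_left hf, homogeneousComponent_eq_self hh]⟩

theorem eq_zero_of_dvd_of_degree_lt {K σ : Type*} [CommRing K] {f h : MvPolynomial σ K}
    {m n : ℕ} (hf : f.IsHomogeneous m) (hh : h.IsHomogeneous n) (hfh : f ∣ h) (hnm : n < m) :
    h = 0 := by
  obtain ⟨g, rfl⟩ := hfh
  rw [← homogeneousComponent_eq_self hh, homogeneousComponent_mul_of_lt hf hnm]

/-- Scaling the point multiplies the value of a form by a power of the factor. -/
theorem aeval_mul_of_isHomogeneous {R A σ : Type*} [CommSemiring R] [CommSemiring A] [Algebra R A]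
    {f : MvPolynomial σ R} {n : ℕ} (hf : f.IsHomogeneous n) (v : σ → A) (c : A) :
    aeval (fun i => v i * c) f = aeval v f * c ^ n := by
  rw [aeval_def, eval₂_eq, aeval_def, eval₂_eq, Finset.sum_mul]
  refine Finset.sum_congr rfl fun d hd => ?_
  simp only [mul_pow, Finset.prod_mul_distrib, Finset.prod_pow_eq_pow_sum]
  rw [hf.degree_eq_sum_deg_support hd, mul_assoc]

theorem eval_smul_of_isHomogeneous {R σ : Type*} [CommSemiring R]
    {f : MvPolynomial σ R} {n : ℕ} (hf : f.IsHomogeneous n) (v : σ → R) (c : R) :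
    eval (c • v) f = c ^ n * eval v f := by
  have := aeval_mul_of_isHomogeneous hf v c
  rw [mul_comm (c ^ n)]
  change aeval (c • v) f = aeval v f * c ^ n
  rw [← this]
  congr 2
  ext i
  simp [mul_comm]

theorem eq_C_of_isHomogeneous_zero {K σ : Type*} [CommRing K] {f : MvPolynomial σ K}
    (hf : f.IsHomogeneous 0) : f = C (coeff 0 f) := by
  rw [← homogeneousComponent_zero, homogeneousComponent_eq_self hf]

/-- A binary form is a multiple of `T₁` up to a multiple of a power of `T₂`. -/
theorem exists_eq_X_zero_mul_add {K : Type*} [Field K] {f : TPoly K} {n : ℕ}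
    (hf : f.IsHomogeneous (n + 1)) :
    ∃ (g : TPoly K) (c : K), g.IsHomogeneous n ∧ f = X 0 * g + C c * X 1 ^ (n + 1) := by
  -- Modulo `X 0` the only monomial of degree `n + 1` is the pure power of `X 1`, whose term is
  -- subtracted here.
  have key : f - C (coeff (Finsupp.single 1 (n + 1)) f) * X 1 ^ (n + 1) ∈
      Ideal.span {(X 0 : TPoly K)} := by
    rw [Ideal.mem_span_singleton, X_dvd_iff_modMonomial_eq_zero]
    ext m
    by_cases hm : Finsupp.single 0 1 ≤ m
    · rw [coeff_modMonomial_of_le _ hm, coeff_zero]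
    · rw [coeff_modMonomial_of_not_le _ hm, coeff_zero, coeff_sub, coeff_C_mul, coeff_X_pow]
      have h0 : m 0 = 0 := by
        by_contra h
        exact hm (by simpa [Nat.one_le_iff_ne_zero] using h)
      by_cases hd : m.degree = n + 1
      · have : m = Finsupp.single 1 (n + 1) := by
          have := Finsupp.degree_eq_sum m
          ext i
          fin_cases i <;> simp_all
        simp [this]
      · rw [hf.coeff_eq_zero hd, if_neg]
        · simp
        · rintro rfl
          simp at hd
  have hh : (f - C (coeff (Finsupp.single 1 (n + 1)) f) * X 1 ^ (n + 1)).IsHomogeneous (1 + n) := by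
    rw [add_comm 1 n]
    exact hf.sub ((isHomogeneous_X_pow 1 (n + 1)).C_mul _)
  obtain ⟨g, hg, h⟩ := exists_form_of_dvd (isHomogeneous_X K (0 : Fin 2)) hh
    (Ideal.mem_span_singleton.1 key)
  exact ⟨g, _, hg, by rw [← h]; ring⟩

theorem exists_eq_mul_X_add_mul_X {K : Type*} [Field K] {f : TPoly K} {n : ℕ}
    (hf : f.IsHomogeneous (n + 1)) :
    ∃ a b : TPoly K, a.IsHomogeneous n ∧ b.IsHomogeneous n ∧ f = a * X 0 + b * X 1 := by
  obtain ⟨g, c, hg, h⟩ := exists_eq_X_zero_mul_add hf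
  exact ⟨g, C c * X 1 ^ n, hg, (isHomogeneous_X_pow 1 n).C_mul c, by rw [h]; ring⟩

theorem aeval_one_X_ne_zero {K : Type*} [Field K] {f : TPoly K} {n : ℕ}
    (hf : f.IsHomogeneous n) (h0 : f ≠ 0) :
    aeval ![1, (Polynomial.X : Polynomial K)] f ≠ 0 := by
  -- The degree bound is carried along in the induction: it isolates `c` as the coefficient of
  -- degree `n + 1`.
  have key : ∀ (n : ℕ) (f : TPoly K), f.IsHomogeneous n →
      (aeval ![1, (Polynomial.X : Polynomial K)] f).natDegree ≤ n ∧
      (aeval ![1, (Polynomial.X : Polynomial K)] f = 0 → f = 0) := by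
    intro n
    induction n with
    | zero =>
      intro f hf
      rw [eq_C_of_isHomogeneous_zero hf]
      simp
    | succ n ih =>
      intro f hf
      obtain ⟨g, c, hg, rfl⟩ := exists_eq_X_zero_mul_add hf
      obtain ⟨h1, h2⟩ := ih g hg
      simp only [map_add, map_mul, map_pow, aeval_X, aeval_C, Matrix.cons_val_zero,
        Matrix.cons_val_one, one_mul]
      constructor
      · refine (Polynomial.natDegree_add_le _ _).trans (max_le (by omega) ?_)
        exact Polynomial.natDegree_C_mul_X_pow_le _ _
      · intro h
        have hc : c = 0 := by
          have := congrArg (fun p => Polynomial.coeff p (n + 1)) h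
          simpa [Polynomial.coeff_eq_zero_of_natDegree_lt (Nat.lt_succ_of_le h1),
            Polynomial.algebraMap_eq, Polynomial.coeff_C_mul] using this
        subst hc
        have : g = 0 := h2 (by simpa using h)
        simp [this]
  exact fun h => h0 ((key n f hf).2 h)

/-- A nonzero binary form has only finitely many zeros on the projective line. -/
theorem finite_zeros {K : Type*} [Field K] {f : TPoly K} {n : ℕ}
    (hf : f.IsHomogeneous n) (h0 : f ≠ 0) :
    {t : ℙ K (Fin 2 → K) | eval t.rep f = 0}.Finite := by
  set p := aeval ![1, (Polynomial.X : Polynomial K)] f with hp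
  have hp0 : p ≠ 0 := aeval_one_X_ne_zero hf h0
  have hne : ∀ s : K, (![1, s] : Fin 2 → K) ≠ 0 := fun s h => one_ne_zero (congrFun h 0)
  have hne' : (![0, 1] : Fin 2 → K) ≠ 0 := fun h => one_ne_zero (congrFun h 1)
  -- The point (0 : 1) is set apart; every other zero is (1 : s) with s a root of `p`.
  refine ((Set.finite_singleton (Projectivization.mk K ![0, 1] hne')).union
    ((p.rootSet_finite K).image fun s => Projectivization.mk K ![1, s] (hne s))).subset ?_
  intro t ht
  by_cases h : t.rep 0 = 0
  · left
    have h1 : t.rep 1 ≠ 0 := fun h1 => t.rep_nonzero (by ext i; fin_cases i <;> simp [h, h1])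
    rw [Set.mem_singleton_iff, ← t.mk_rep, Projectivization.mk_eq_mk_iff']
    exact ⟨t.rep 1, by ext i; fin_cases i <;> simp [h]⟩
  · right
    refine ⟨t.rep 1 / t.rep 0, ?_, ?_⟩
    · rw [Polynomial.mem_rootSet]
      refine ⟨hp0, ?_⟩
      have h2 : t.rep = t.rep 0 • ![1, t.rep 1 / t.rep 0] := by
        ext i; fin_cases i <;> simp [mul_div_cancel₀, h]
      have h3 : eval (![1, t.rep 1 / t.rep 0] : Fin 2 → K) f = 0 := by
        have h4 : eval t.rep f = 0 := ht
        rw [h2, eval_smul_of_isHomogeneous hf] at h4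
        simpa [h] using h4
      rw [hp, ← AlgHom.comp_apply, ← h3, comp_aeval, ← coe_aeval_eq_eval]
      have h5 : (fun i => Polynomial.aeval (t.rep 1 / t.rep 0) (![1, (Polynomial.X : Polynomial K)] i)) =
          ![1, t.rep 1 / t.rep 0] := by
        ext i; fin_cases i <;> simp
      rw [← h5]
      rfl
    · conv_rhs => rw [← t.mk_rep]
      rw [Projectivization.mk_eq_mk_iff']
      exact ⟨(t.rep 0)⁻¹, by ext i; fin_cases i <;> simp [h, div_eq_inv_mul]⟩

theorem infinite_projectiveLine (K : Type*) [Field K] [Infinite K] :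
    (Set.univ : Set (ℙ K (Fin 2 → K))).Infinite := by
  have hne : ∀ s : K, (![1, s] : Fin 2 → K) ≠ 0 := fun s h => one_ne_zero (congrFun h 0)
  have : Function.Injective fun s : K => Projectivization.mk K ![1, s] (hne s) := by
    intro s t h
    rw [Projectivization.mk_eq_mk_iff'] at h
    obtain ⟨a, ha⟩ := h
    have h0 := congrFun ha 0
    have h1 := congrFun ha 1
    simp at h0 h1
    simp [← h1, h0]
  exact (Set.infinite_range_of_injective this).mono (Set.subset_univ _)

/-- A binary form that vanishes almost everywhere is zero. -/
theorem eq_zero_of_finite_nonzeros {K : Type*} [Field K] [Infinite K] {f : TPoly K} {n : ℕ}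
    (hf : f.IsHomogeneous n) (h : {t : ℙ K (Fin 2 → K) | eval t.rep f ≠ 0}.Finite) : f = 0 := by
  by_contra h0
  refine infinite_projectiveLine K (((finite_zeros hf h0).union h).subset fun t _ => ?_)
  exact em (eval t.rep f = 0)

/-! ### Dimension counts -/

/-- Two coprime members of a linear system of forms without common factors. -/
theorem exists_isRelPrime_combination {K : Type*} [Field K] [Infinite K] {u : Fin 3 → TPoly K}
    (hnc : NoCommonFactor u) :
    ∃ v w : Fin 3 → K, ∑ i, v i • u i ≠ 0 ∧ IsRelPrime (∑ i, v i • u i) (∑ i, w i • u i) := by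
  classical
  obtain ⟨i₀, hi₀⟩ : ∃ i, u i ≠ 0 := by
    by_contra! h
    exact not_isUnit_zero (hnc 0 fun i => by simp [h i])
  have hv : ∑ i, (Pi.single i₀ 1 : Fin 3 → K) i • u i = u i₀ := by
    simp [Pi.single_apply, ite_smul]
  -- For an irreducible factor p of `u i₀`, the coefficient vectors whose combination is divisible
  -- by p form a proper subspace, since p is not a common factor. Finitely many proper subspaces do
  -- not cover the space over an infinite field.
  let V : TPoly K → Submodule K (Fin 3 → K) := fun p =>
    ((Ideal.span {p}).restrictScalars K).comap (Fintype.linearCombination K u)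
  have hV : ∀ p c, c ∈ V p ↔ p ∣ ∑ i, c i • u i := fun p c => by
    simp [V, Ideal.mem_span_singleton, Fintype.linearCombination_apply]
  have htop : ⊤ ∉ (UniqueFactorizationMonoid.factors (u i₀)).toFinset.image V := by
    simp only [Finset.mem_image, Multiset.mem_toFinset, not_exists, not_and]
    intro p hp h
    refine (UniqueFactorizationMonoid.irreducible_of_factor p hp).not_isUnit (hnc p fun i => ?_)
    have : (Pi.single i 1 : Fin 3 → K) ∈ V p := h ▸ Submodule.mem_top
    rw [hV] at this
    simpa [Pi.single_apply, ite_smul] using this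
  obtain ⟨w, hw⟩ := (Set.ne_univ_iff_exists_notMem _).1
    (Subspace.biUnion_ne_univ_of_top_notMem htop)
  refine ⟨Pi.single i₀ 1, w, by rwa [hv], ?_⟩
  rw [hv]
  refine WfDvdMonoid.isRelPrime_of_no_irreducible_factors (fun h => hi₀ h.1) fun p hp h1 h2 => ?_
  obtain ⟨q, hq, hpq⟩ := UniqueFactorizationMonoid.exists_mem_factors_of_dvd hi₀ hp h1
  refine hw (Set.mem_biUnion (Finset.mem_coe.2
    (Finset.mem_image_of_mem V (Multiset.mem_toFinset.2 hq))) ?_)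
  exact (hV q w).2 (hpq.dvd_iff_dvd_left.1 h2)

/-- Powers of coprime forms of degree `d` are independent over the forms of smaller degree. -/
theorem eq_zero_of_sum_mul_pow_eq_zero {K : Type*} [Field K] {f g : TPoly K} {d D : ℕ}
    (hf : f.IsHomogeneous d) (hf0 : f ≠ 0) (hfg : IsRelPrime f g) (hD : D < d) (j : ℕ) :
    ∀ r : ℕ → TPoly K, (∀ s, (r s).IsHomogeneous D) →
      ∑ s ∈ Finset.range (j + 1), r s * (f ^ s * g ^ (j - s)) = 0 → ∀ s ≤ j, r s = 0 := by
  induction j with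
  | zero =>
    intro r _ h s hs
    obtain rfl : s = 0 := by omega
    simpa using h
  | succ j ih =>
    intro r hr h
    rw [Finset.sum_range_succ'] at h
    have h1 : ∑ s ∈ Finset.range (j + 1), r (s + 1) * (f ^ (s + 1) * g ^ (j + 1 - (s + 1))) =
        f * ∑ s ∈ Finset.range (j + 1), r (s + 1) * (f ^ s * g ^ (j - s)) := by
      rw [Finset.mul_sum]
      refine Finset.sum_congr rfl fun s _ => ?_
      rw [Nat.add_sub_add_right, pow_succ]
      ring
    rw [h1] at h
    -- All terms with s ≥ 1 are divisible by `f`, so `f` divides `r 0 * g ^ (j + 1)`, hence `r 0`,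
    -- whose degree is too small.
    have h0 : r 0 = 0 := by
      refine eq_zero_of_dvd_of_degree_lt hf (hr 0) ?_ hD
      refine IsRelPrime.dvd_of_dvd_mul_right (z := g ^ (j + 1)) hfg.pow_right ?_
      rw [pow_zero, one_mul, Nat.sub_zero] at h
      rw [eq_neg_of_add_eq_zero_right h]
      exact (Dvd.intro _ rfl : f ∣ f * _).neg_right
    rw [h0, zero_mul, add_zero, mul_eq_zero, or_iff_right hf0] at h
    intro s hs
    obtain _ | s := s
    · exact h0
    · exact ih (fun s => r (s + 1)) (fun s => hr _) h s (by omega)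

/-- The multiples of `H` by forms of degree `n`. -/
def formMultiples {K : Type*} [Field K] (H : XPoly K) (n : ℕ) : Submodule K (XPoly K) :=
  (homogeneousSubmodule (Fin 3) K n).map (LinearMap.mulLeft K H)

instance {K : Type*} [Field K] (H : XPoly K) (n : ℕ) :
    FiniteDimensional K (formMultiples H n) := by
  unfold formMultiples
  infer_instance

theorem finrank_formMultiples {K : Type*} [Field K] {H : XPoly K} (hH : H ≠ 0) (n : ℕ) :
    finrank K (formMultiples H n) = (n + 2).choose 2 := by
  rw [← finrank_forms K 2 n]
  exact (Submodule.equivMapOfInjective (LinearMap.mulLeft K H)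
    (mul_right_injective₀ hH) (homogeneousSubmodule (Fin 3) K n)).finrank_eq.symm

theorem formMultiples_le {K : Type*} [Field K] {H : XPoly K} {h : ℕ} (hH : H.IsHomogeneous h)
    (n : ℕ) : formMultiples H n ≤ homogeneousSubmodule (Fin 3) K (h + n) := by
  rintro _ ⟨g, hg, rfl⟩
  exact hH.mul hg

theorem formMultiples_le_ker {K : Type*} [Field K] {H : XPoly K} {u : Fin 3 → TPoly K}
    (hH : aeval u H = 0) (n : ℕ) :
    formMultiples H n ≤ LinearMap.ker (aeval u : XPoly K →ₐ[K] TPoly K).toLinearMap := by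
  rintro _ ⟨g, -, rfl⟩
  change aeval u (H * g) = 0
  rw [map_mul, hH, zero_mul]

theorem two_mul_choose_add_two (m : ℕ) : 2 * (m + 2).choose 2 = (m + 2) * (m + 1) := by
  have h1 := Nat.choose_two_right (m + 2)
  have h2 : 2 ∣ (m + 2) * (m + 2 - 1) := (Nat.even_mul_pred_self _).two_dvd
  rw [h1, Nat.mul_div_cancel' h2]
  rfl

section

variable {K : Type*} [Field K] [Infinite K] {u : Fin 3 → TPoly K} {F : Fin 2 → XPoly K}
  {G : TPoly K} {D : ℕ}

/-- Bound for the space of forms of degree `n` that vanish on a curve with a parameterization of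
degree `D + 1` that has an inverse. -/
theorem finrank_add_le (hu : ∀ i, (u i).IsHomogeneous (D + 1)) (hnc : NoCommonFactor u)
    (hF : ∀ i, (F i).IsHomogeneous 2) (hG : ∀ i, aeval u (F i) = X i * G) (hG0 : G ≠ 0)
    (j : ℕ) (W : Submodule K (XPoly K)) (hW : W ≤ homogeneousSubmodule (Fin 3) K (j + 2 * D))
    (hWu : W ≤ LinearMap.ker (aeval u : XPoly K →ₐ[K] TPoly K).toLinearMap) :
    (D + 1) * (j + 1) + finrank K W ≤ (j + 2 * D + 2).choose 2 := by
  obtain ⟨v, w, hf0, hfg⟩ := exists_isRelPrime_combination hnc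
  set f := ∑ i, v i • u i with hf
  set g := ∑ i, w i • u i with hg
  have hfh : f.IsHomogeneous (D + 1) := Submodule.sum_mem (homogeneousSubmodule _ K _)
    fun i _ => Submodule.smul_mem _ _ (hu i)
  let p : XPoly K := ∑ i, v i • X i
  let q : XPoly K := ∑ i, w i • X i
  have hp : p.IsHomogeneous 1 := Submodule.sum_mem (homogeneousSubmodule _ K _)
    fun i _ => Submodule.smul_mem _ _ (isHomogeneous_X K i)
  have hq : q.IsHomogeneous 1 := Submodule.sum_mem (homogeneousSubmodule _ K _)
    fun i _ => Submodule.smul_mem _ _ (isHomogeneous_X K i)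
  -- The pull-back along `u` turns r(F) into r · G^D and `p`, `q` into `f`, `g`; so the independence
  -- of the products of powers of `f` and `g` makes Φ injective even on the curve.
  let Φ : (Fin (j + 1) → homogeneousSubmodule (Fin 2) K D) →ₗ[K] XPoly K :=
    { toFun := fun r => ∑ s, aeval F (r s).1 * (p ^ s.1 * q ^ (j - s.1))
      map_add' := fun r r' => by simp [add_mul, Finset.sum_add_distrib]
      map_smul' := fun c r => by simp [Finset.smul_sum] }
  have hΦ : ∀ r, aeval u (Φ r) =
      (∑ s : Fin (j + 1), (r s).1 * (f ^ s.1 * g ^ (j - s.1))) * G ^ D := by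
    intro r
    simp only [Φ, LinearMap.coe_mk, AddHom.coe_mk, map_sum, map_mul, map_pow, Finset.sum_mul, p, q,
      map_smul, aeval_X, ← hf, ← hg]
    refine Finset.sum_congr rfl fun s _ => ?_
    have h1 : aeval u (aeval F (r s).1) = (r s).1 * G ^ D := by
      rw [← AlgHom.comp_apply, comp_aeval]
      simp only [hG]
      rw [aeval_mul_of_isHomogeneous (r s).2, aeval_X_left_apply]
    rw [h1]
    ring
  have hker : ∀ r, aeval u (Φ r) = 0 → r = 0 := by
    intro r h
    rw [hΦ, mul_eq_zero, or_iff_left (pow_ne_zero _ hG0)] at h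
    have h2 := eq_zero_of_sum_mul_pow_eq_zero hfh hf0 hfg (Nat.lt_succ_self D) j
      (fun s => if hs : s < j + 1 then (r ⟨s, hs⟩).1 else 0)
      (fun s => by
        split_ifs with hs
        · exact (r ⟨s, hs⟩).2
        · exact isHomogeneous_zero _ _ _)
      (by
        rw [Finset.sum_range, ← h]
        refine Finset.sum_congr rfl fun s _ => ?_
        rw [dif_pos s.2])
    ext1 s
    have := h2 s.1 (Nat.le_of_lt_succ s.2)
    rw [dif_pos s.2] at this
    exact Subtype.ext this
  have hinj : Function.Injective Φ := by
    rw [← LinearMap.ker_eq_bot, LinearMap.ker_eq_bot']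
    exact fun r hr => hker r (by rw [hr, map_zero])
  have hrange : LinearMap.range Φ ≤ homogeneousSubmodule (Fin 3) K (j + 2 * D) := by
    rintro _ ⟨r, rfl⟩
    change ∑ s : Fin (j + 1), aeval F (r s).1 * (p ^ s.1 * q ^ (j - s.1)) ∈ _
    refine Submodule.sum_mem _ fun s _ => ?_
    have h1 : (aeval F (r s).1).IsHomogeneous (2 * D) := IsHomogeneous.aeval (r s).2 F hF
    have h2 := h1.mul ((hp.pow s.1).mul (hq.pow (j - s.1)))
    have h3 : 2 * D + (1 * s.1 + 1 * (j - s.1)) = j + 2 * D := by have := s.2; omega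
    rwa [h3] at h2
  have : FiniteDimensional K W := Submodule.finiteDimensional_of_le hW
  have hinf : LinearMap.range Φ ⊓ W = ⊥ := by
    rw [eq_bot_iff]
    rintro _ ⟨⟨r, rfl⟩, hr⟩
    rw [hker r (hWu hr), map_zero]
    exact Submodule.zero_mem _
  have h4 := Submodule.finrank_sup_add_finrank_inf_eq (LinearMap.range Φ) W
  rw [hinf, finrank_bot, add_zero, LinearMap.finrank_range_of_inj hinj, finrank_pi_fintype] at h4
  have h5 := Submodule.finrank_mono (sup_le hrange hW)
  rw [h4, finrank_forms K 2] at h5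
  simpa [finrank_forms K 1, mul_comm] using h5

/-- A curve with a parameterization of degree `D + 1` that has an inverse has degree at least
`D + 1`. -/
theorem le_degree_of_vanishes (hu : ∀ i, (u i).IsHomogeneous (D + 1)) (hnc : NoCommonFactor u)
    (hF : ∀ i, (F i).IsHomogeneous 2) (hG : ∀ i, aeval u (F i) = X i * G) (hG0 : G ≠ 0)
    {H : XPoly K} {h : ℕ} (hH : H.IsHomogeneous h) (hH0 : H ≠ 0) (hHu : aeval u H = 0) :
    D + 1 ≤ h := by
  by_contra! hlt
  obtain ⟨c, rfl⟩ : ∃ c, D = h + c := ⟨D - h, by omega⟩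
  -- Put D = h + c. In degree j + 2D, twice the codimension of the multiples of `H` is at most D(2j
  -- + 4D + 3), which for this j is less than 2(D + 1)(j + 1).
  set j := 4 * (h + c) ^ 2 + 3 * (h + c) with hj
  have h1 := finrank_add_le hu hnc hF hG hG0 j (formMultiples H (j + h + 2 * c))
    ((formMultiples_le hH _).trans (le_of_eq (by congr 1; ring))) (formMultiples_le_ker hHu _)
  rw [finrank_formMultiples hH0] at h1
  have h2 := two_mul_choose_add_two (j + h + 2 * c)
  have h3 := two_mul_choose_add_two (j + 2 * (h + c))
  nlinarith

/-- An irreducible form that vanishes on the image of a parameterization divides every other such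
form. -/
theorem dvd_of_vanishes (hu : ∀ i, (u i).IsHomogeneous (D + 1)) (hnc : NoCommonFactor u)
    (hF : ∀ i, (F i).IsHomogeneous 2) (hG : ∀ i, aeval u (F i) = X i * G) (hG0 : G ≠ 0)
    {E H : XPoly K} {e h : ℕ} (hE : Irreducible E) (hEh : E.IsHomogeneous e)
    (hEu : aeval u E = 0) (hH : H.IsHomogeneous h) (hHu : aeval u H = 0) : E ∣ H := by
  by_contra hdvd
  have hH0 : H ≠ 0 := fun h0 => hdvd (h0 ▸ dvd_zero E)
  have hEH : IsRelPrime E H := (hE.isRelPrime_iff_not_dvd).2 hdvd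
  -- In degree j + 2D = m + e + h the forms aE + bH have codimension at most eh, because E and H are
  -- coprime; but (D + 1)(j + 1) > eh.
  set m := 2 * D + e * h with hm
  set j := e * h + e + h with hj
  set A := formMultiples E (m + h)
  set B := formMultiples H (m + e)
  have hinf : A ⊓ B ≤ formMultiples (E * H) m := by
    rintro _ ⟨⟨a, ha, rfl⟩, ⟨b, hb, hab⟩⟩
    simp only [LinearMap.mulLeft_apply] at hab ⊢
    have h1 : H ∣ a := hEH.symm.dvd_of_dvd_mul_left (hab ▸ Dvd.intro _ rfl)
    obtain ⟨c, hc, rfl⟩ := exists_form_of_dvd hH (by rw [add_comm h m]; exact ha) h1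
    exact ⟨c, hc, by simp⟩
  have h1 := finrank_add_le hu hnc hF hG hG0 j (A ⊔ B)
    (sup_le ((formMultiples_le hEh _).trans (le_of_eq (by congr 1; ring)))
      ((formMultiples_le hH _).trans (le_of_eq (by congr 1; ring))))
    (sup_le (formMultiples_le_ker hEu _) (formMultiples_le_ker hHu _))
  have h2 := Submodule.finrank_sup_add_finrank_inf_eq A B
  have h3 := Submodule.finrank_mono hinf
  rw [finrank_formMultiples (mul_ne_zero hE.ne_zero hH0)] at h3
  rw [finrank_formMultiples hE.ne_zero, finrank_formMultiples hH0] at h2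
  have h4 := two_mul_choose_add_two m
  have h5 := two_mul_choose_add_two (m + h)
  have h6 := two_mul_choose_add_two (m + e)
  have h7 := two_mul_choose_add_two (j + 2 * D)
  have h8 : j + 2 * D = m + e + h := by rw [hj, hm]; ring
  rw [h8] at h1 h7
  have h9 : 2 * ((D + 1) * (j + 1)) ≤ 2 * (e * h) := by nlinarith
  nlinarith

end

/-! ### Bihomogeneous polynomials -/

section Bihomogeneous

variable {K : Type*} [Field K] {V W : TXPoly K} {i j i' j' : ℕ}

theorem isBihomogeneous_zero (i j : ℕ) : IsBihomogeneous (0 : TXPoly K) i j :=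
  ⟨isHomogeneous_zero _ _ _, fun m => by rw [coeff_zero]; exact isHomogeneous_zero _ _ _⟩

theorem IsBihomogeneous.add (hV : IsBihomogeneous V i j) (hW : IsBihomogeneous W i j) :
    IsBihomogeneous (V + W) i j :=
  ⟨hV.1.add hW.1, fun m => by rw [coeff_add]; exact (hV.2 m).add (hW.2 m)⟩

theorem IsBihomogeneous.neg (hV : IsBihomogeneous V i j) : IsBihomogeneous (-V) i j :=
  ⟨hV.1.neg, fun m => by rw [coeff_neg]; exact (hV.2 m).neg⟩

theorem IsBihomogeneous.sub (hV : IsBihomogeneous V i j) (hW : IsBihomogeneous W i j) :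
    IsBihomogeneous (V - W) i j := sub_eq_add_neg V W ▸ hV.add hW.neg

theorem IsBihomogeneous.mul (hV : IsBihomogeneous V i j) (hW : IsBihomogeneous W i' j') :
    IsBihomogeneous (V * W) (i + i') (j + j') := by
  classical
  refine ⟨hV.1.mul hW.1, fun m => ?_⟩
  rw [coeff_mul]
  exact IsHomogeneous.sum _ _ _ fun p _ => (hV.2 _).mul (hW.2 _)

theorem IsBihomogeneous.sum {ι : Type*} (s : Finset ι) {f : ι → TXPoly K}
    (h : ∀ a ∈ s, IsBihomogeneous (f a) i j) : IsBihomogeneous (∑ a ∈ s, f a) i j :=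
  ⟨IsHomogeneous.sum _ _ _ fun a ha => (h a ha).1, fun m => by
    rw [coeff_sum]
    exact IsHomogeneous.sum _ _ _ fun a ha => (h a ha).2 m⟩

theorem isBihomogeneous_monomial {m : Fin 3 →₀ ℕ} {r : TPoly K} (hr : r.IsHomogeneous i)
    (hm : m.degree = j) : IsBihomogeneous (monomial m r) i j := by
  classical
  refine ⟨isHomogeneous_monomial r hm, fun m' => ?_⟩
  rw [coeff_monomial]
  split_ifs
  · exact hr
  · exact isHomogeneous_zero _ _ _

theorem isBihomogeneous_C {r : TPoly K} (hr : r.IsHomogeneous i) :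
    IsBihomogeneous (C r : TXPoly K) i 0 := isBihomogeneous_monomial hr (by simp)

theorem isBihomogeneous_T (s : Fin 2) : IsBihomogeneous (T s : TXPoly K) 1 0 :=
  isBihomogeneous_C (isHomogeneous_X K s)

theorem isBihomogeneous_T_pow (s : Fin 2) (n : ℕ) : IsBihomogeneous (T s ^ n : TXPoly K) n 0 := by
  rw [T, ← C_pow]
  exact isBihomogeneous_C (isHomogeneous_X_pow s n)

theorem isBihomogeneous_inX {f : XPoly K} (hf : f.IsHomogeneous j) :
    IsBihomogeneous (inX f) 0 j :=
  ⟨hf.map _, fun m => by rw [inX, coeff_map]; exact isHomogeneous_C _ _⟩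

theorem isBihomogeneous_movingLine {a : Fin 3 → TPoly K} (ha : ∀ s, (a s).IsHomogeneous i) :
    IsBihomogeneous (movingLine a) i 1 :=
  IsBihomogeneous.sum _ fun s _ => by
    have h : IsBihomogeneous (X s : TXPoly K) 0 1 :=
      isBihomogeneous_monomial (isHomogeneous_one _ _) (by simp)
    simpa using (isBihomogeneous_C (ha s)).mul h

theorem isBihomogeneous_pencil {F : Fin 2 → XPoly K} (hF : ∀ s, (F s).IsHomogeneous j) :
    IsBihomogeneous (pencil F) 1 j := by
  have := ((isBihomogeneous_T 0).mul (isBihomogeneous_inX (hF 1))).sub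
    ((isBihomogeneous_T 1).mul (isBihomogeneous_inX (hF 0)))
  simpa [pencil] using this

theorem sum_support_monomial (W : TXPoly K) (f : (Fin 3 →₀ ℕ) → TPoly K)
    (h : ∀ m, coeff m W = 0 → f m = 0)
    (m : Fin 3 →₀ ℕ) : coeff m (∑ p ∈ W.support, monomial p (f p)) = f m := by
  classical
  simp only [coeff_sum, coeff_monomial]
  rw [Finset.sum_ite_eq' W.support m f]
  split_ifs with hm
  · rfl
  · exact (h m (MvPolynomial.notMem_support_iff.1 hm)).symm

/-- The component of degree `i` in `T` and `j` in `X`. -/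
def bihomogeneousComponent (i j : ℕ) (W : TXPoly K) : TXPoly K :=
  ∑ m ∈ W.support, monomial m (if m.degree = j then homogeneousComponent i (coeff m W) else 0)

theorem coeff_bihomogeneousComponent (i j : ℕ) (W : TXPoly K) (m : Fin 3 →₀ ℕ) :
    coeff m (bihomogeneousComponent i j W) =
      if m.degree = j then homogeneousComponent i (coeff m W) else 0 :=
  sum_support_monomial W _ (fun m hm => by simp [hm]) m

theorem isBihomogeneous_bihomogeneousComponent (i j : ℕ) (W : TXPoly K) :
    IsBihomogeneous (bihomogeneousComponent i j W) i j :=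
  IsBihomogeneous.sum _ fun m _ => by
    split_ifs with h
    · exact isBihomogeneous_monomial (homogeneousComponent_isHomogeneous _ _) h
    · rw [monomial_zero]
      exact isBihomogeneous_zero _ _

theorem IsBihomogeneous.component_eq (hW : IsBihomogeneous W i j) :
    bihomogeneousComponent i j W = W := by
  ext1 m
  rw [coeff_bihomogeneousComponent]
  split_ifs with h
  · exact homogeneousComponent_eq_self (hW.2 m)
  · exact (hW.1.coeff_eq_zero h).symm

theorem bihomogeneousComponent_sum {ι : Type*} (s : Finset ι) (f : ι → TXPoly K) :
    bihomogeneousComponent i j (∑ a ∈ s, f a) = ∑ a ∈ s, bihomogeneousComponent i j (f a) := by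
  ext1 m
  simp only [coeff_bihomogeneousComponent, coeff_sum, map_sum]
  split_ifs <;> simp

theorem bihomogeneousComponent_mul (hV : IsBihomogeneous V i j) (i' j' : ℕ) (W : TXPoly K) :
    bihomogeneousComponent (i + i') (j + j') (V * W) = V * bihomogeneousComponent i' j' W := by
  classical
  ext1 m
  rw [coeff_bihomogeneousComponent, coeff_mul, coeff_mul, map_sum]
  split_ifs with h
  · refine Finset.sum_congr rfl fun p hp => ?_
    rw [homogeneousComponent_mul_left (hV.2 _), coeff_bihomogeneousComponent]
    by_cases hp1 : p.1.degree = j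
    · rw [if_pos]
      have := congrArg Finsupp.degree (Finset.HasAntidiagonal.mem_antidiagonal.1 hp)
      rw [map_add] at this
      omega
    · rw [hV.1.coeff_eq_zero hp1, zero_mul, zero_mul]
  · symm
    refine Finset.sum_eq_zero fun p hp => ?_
    rw [coeff_bihomogeneousComponent]
    by_cases hp1 : p.1.degree = j
    · rw [if_neg, mul_zero]
      have := congrArg Finsupp.degree (Finset.HasAntidiagonal.mem_antidiagonal.1 hp)
      rw [map_add] at this
      omega
    · rw [hV.1.coeff_eq_zero hp1, zero_mul]

theorem bihomogeneousComponent_mul_eq_zero (hV : IsBihomogeneous V i j)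
    (h : ¬ (i ≤ i' ∧ j ≤ j')) (W : TXPoly K) : bihomogeneousComponent i' j' (V * W) = 0 := by
  classical
  ext1 m
  rw [coeff_bihomogeneousComponent, coeff_mul, map_sum, coeff_zero]
  split_ifs with hm
  · refine Finset.sum_eq_zero fun p hp => ?_
    by_cases hp1 : p.1.degree = j
    · refine homogeneousComponent_mul_of_lt (hV.2 _) ?_
      have := congrArg Finsupp.degree (Finset.HasAntidiagonal.mem_antidiagonal.1 hp)
      rw [map_add] at this
      omega
    · rw [hV.1.coeff_eq_zero hp1, zero_mul, map_zero]
  · rfl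

theorem mem_of_bihomogeneousComponent_mem {I : Ideal (TXPoly K)}
    (h : ∀ i j, bihomogeneousComponent i j W ∈ I) : W ∈ I := by
  classical
  set N := W.support.sup (fun m => (coeff m W).totalDegree) + 1 with hN
  set M := W.support.sup Finsupp.degree + 1 with hM
  have : W = ∑ i ∈ Finset.range N, ∑ j ∈ Finset.range M, bihomogeneousComponent i j W := by
    ext1 m
    simp only [coeff_sum, coeff_bihomogeneousComponent, Finset.sum_ite_eq]
    by_cases hm : m ∈ W.support
    · have h1 : m.degree ∈ Finset.range M :=
        Finset.mem_range.2 (Nat.lt_succ_of_le (Finset.le_sup (f := Finsupp.degree) hm))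
      simp only [if_pos h1]
      have h2 : (coeff m W).totalDegree + 1 ≤ N :=
        Nat.succ_le_succ (Finset.le_sup (f := fun m => (coeff m W).totalDegree) hm)
      rw [← Finset.sum_subset (Finset.range_mono h2), sum_homogeneousComponent]
      intro i _ hi
      exact homogeneousComponent_eq_zero _ _ (by simpa using hi)
    · rw [MvPolynomial.notMem_support_iff] at hm
      simp [hm]
  rw [this]
  exact Ideal.sum_mem _ fun i _ => Ideal.sum_mem _ fun j _ => h i j

/-- A bihomogeneous element of an ideal with bihomogeneous generators only involves the generators
of smaller bidegree. -/
theorem mem_span_of_isBihomogeneous {ι : Type*} {y : ι → TXPoly K} {a b : ι → ℕ}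
    (hy : ∀ s, IsBihomogeneous (y s) (a s) (b s)) {S : Set ι} (hW : IsBihomogeneous W i j)
    (h : W ∈ Ideal.span (y '' S)) : W ∈ Ideal.span (y '' {s | s ∈ S ∧ a s ≤ i ∧ b s ≤ j}) := by
  obtain ⟨l, hl, rfl⟩ := (Finsupp.mem_span_image_iff_linearCombination _).1 h
  -- In the component of bidegree (i, j), the summands whose generator has too large a degree in T
  -- or X disappear.
  rw [← hW.component_eq, Finsupp.linearCombination_apply, Finsupp.sum, bihomogeneousComponent_sum]
  refine Ideal.sum_mem _ fun s hs => ?_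
  rw [smul_eq_mul, mul_comm]
  by_cases hab : a s ≤ i ∧ b s ≤ j
  · obtain ⟨i', rfl⟩ := Nat.exists_eq_add_of_le hab.1
    obtain ⟨j', rfl⟩ := Nat.exists_eq_add_of_le hab.2
    rw [bihomogeneousComponent_mul (hy s)]
    exact Ideal.mul_mem_right _ _ (Ideal.subset_span ⟨s, ⟨hl hs, hab⟩, rfl⟩)
  · rw [bihomogeneousComponent_mul_eq_zero (hy s) hab]
    exact Ideal.zero_mem _

/-- A polynomial that is homogeneous in `T` is a multiple of `T₁` up to a multiple of a power of
`T₂`. -/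
theorem exists_eq_T_zero_mul_add (hW : ∀ m, (coeff m W).IsHomogeneous (i + 1)) :
    ∃ (V : TXPoly K) (w : XPoly K), (∀ m, (coeff m V).IsHomogeneous i) ∧
      W = T 0 * V + inX w * T 1 ^ (i + 1) ∧
      (W.IsHomogeneous j → V.IsHomogeneous j ∧ w.IsHomogeneous j) := by
  classical
  choose g c hg h using fun m => exists_eq_X_zero_mul_add (hW m)
  refine ⟨∑ m ∈ W.support, monomial m (g m), ∑ m ∈ W.support, monomial m (c m), ?_, ?_, ?_⟩
  · intro m
    simp only [coeff_sum]
    refine IsHomogeneous.sum _ _ _ fun p _ => ?_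
    rw [coeff_monomial]
    split_ifs
    · exact hg p
    · exact isHomogeneous_zero _ _ _
  · conv_lhs => rw [W.as_sum]
    rw [Finset.mul_sum, map_sum, Finset.sum_mul, ← Finset.sum_add_distrib]
    refine Finset.sum_congr rfl fun m _ => ?_
    rw [inX, map_monomial, T, T, ← C_pow, C_mul_monomial, mul_comm (monomial m _) (C _),
      C_mul_monomial, ← map_add, mul_comm (X 1 ^ (i + 1)), ← h]
  · intro hWj
    have hm : ∀ m ∈ W.support, m.degree = j := fun m hm => by
      by_contra hne
      exact mem_support_iff.1 hm (hWj.coeff_eq_zero hne)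
    exact ⟨IsHomogeneous.sum _ _ _ fun m h => isHomogeneous_monomial _ (hm m h),
      IsHomogeneous.sum _ _ _ fun m h => isHomogeneous_monomial _ (hm m h)⟩

theorem IsBihomogeneous.exists_eq_mul_T_add (hW : IsBihomogeneous W (i + 1) j) :
    ∃ A B : TXPoly K, IsBihomogeneous A i j ∧ IsBihomogeneous B i j ∧ W = A * T 0 + B * T 1 := by
  obtain ⟨V, w, hV, h, hj⟩ := exists_eq_T_zero_mul_add (j := j) hW.2
  refine ⟨V, inX w * T 1 ^ i, ⟨(hj hW.1).1, hV⟩, ?_, by rw [h]; ring⟩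
  simpa using (isBihomogeneous_inX (hj hW.1).2).mul (isBihomogeneous_T_pow 1 i)

theorem eq_inX_of_coeff_isHomogeneous_zero (hW : ∀ m, (coeff m W).IsHomogeneous 0) :
    ∃ w : XPoly K, W = inX w := by
  refine ⟨∑ m ∈ W.support, monomial m (coeff 0 (coeff m W)), ?_⟩
  conv_lhs => rw [W.as_sum]
  rw [map_sum]
  refine Finset.sum_congr rfl fun m _ => ?_
  rw [inX, map_monomial, ← eq_C_of_isHomogeneous_zero (hW m)]

end Bihomogeneous

/-! ### The substitutions `T ↦ F(X)` and `X ↦ u(T)` -/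

section Substitution

variable {K : Type*} [Field K] {u : Fin 3 → TPoly K} {F : Fin 2 → XPoly K} {G : TPoly K}
  {W : TXPoly K} {d i j n : ℕ}

/-- The substitution `T ↦ F(X)`. -/
def substT (F : Fin 2 → XPoly K) : TXPoly K →+* XPoly K :=
  eval₂Hom ((aeval F : TPoly K →ₐ[K] XPoly K) : TPoly K →+* XPoly K) X

theorem substT_C (r : TPoly K) : substT F (C r) = aeval F r := by simp [substT]

theorem substT_T (s : Fin 2) : substT F (T s) = F s := by rw [T, substT_C, aeval_X]

theorem substT_inX (f : XPoly K) : substT F (inX f) = f := by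
  rw [substT, inX, coe_eval₂Hom, eval₂_map]
  have : (((aeval F : TPoly K →ₐ[K] XPoly K) : TPoly K →+* XPoly K).comp C) = C := by
    ext c
    simp
  rw [this, eval₂_eta]

theorem substT_pencil : substT F (pencil F) = 0 := by
  rw [pencil, map_sub, map_mul, map_mul, substT_T, substT_T, substT_inX, substT_inX]
  ring

theorem substT_eq_sum (W : TXPoly K) :
    substT F W = ∑ m ∈ W.support, aeval F (coeff m W) * ∏ s, X s ^ m s := by
  rw [substT, coe_eval₂Hom, eval₂_eq']
  rfl

theorem IsBihomogeneous.substT (hF : ∀ s, (F s).IsHomogeneous n) (hW : IsBihomogeneous W i j) :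
    (substT F W).IsHomogeneous (n * i + j) := by
  rw [substT_eq_sum]
  refine IsHomogeneous.sum _ _ _ fun m hm => (IsHomogeneous.aeval (hW.2 m) F hF).mul ?_
  have h1 : m.degree = j := by
    by_contra hne
    exact mem_support_iff.1 hm (hW.1.coeff_eq_zero hne)
  rw [← h1, Finsupp.degree_eq_sum]
  exact IsHomogeneous.prod _ _ _ fun s _ => isHomogeneous_X_pow s _

theorem aeval_inX (f : XPoly K) : aeval u (inX f) = aeval u f :=
  aeval_map_algebraMap (TPoly K) u f

theorem aeval_T (s : Fin 2) : aeval u (T s : TXPoly K) = (X s : TPoly K) := by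
  rw [T, aeval_C]
  rfl

theorem aeval_movingLine (a : Fin 3 → TPoly K) : aeval u (movingLine a) = ∑ s, a s * u s := by
  simp [movingLine, map_sum]

theorem aeval_pencil (hG : ∀ s, aeval u (F s) = X s * G) : aeval u (pencil F) = 0 := by
  rw [pencil, map_sub, map_mul, map_mul, aeval_T, aeval_T, aeval_inX, aeval_inX, hG, hG]
  ring

theorem aeval_eq_sum (W : TXPoly K) :
    aeval u W = ∑ m ∈ W.support, coeff m W * ∏ s, u s ^ m s := by
  rw [aeval_def, eval₂_eq']
  rfl

/-- The composite substitution sends T to F(u) = T · G, and the scalar G comes out with exponent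
equal to the T-degree. -/
theorem aeval_substT (hG : ∀ s, aeval u (F s) = X s * G)
    (hW : ∀ m, (coeff m W).IsHomogeneous i) : aeval u (substT F W) = aeval u W * G ^ i := by
  rw [substT_eq_sum, aeval_eq_sum, map_sum, Finset.sum_mul]
  refine Finset.sum_congr rfl fun m _ => ?_
  rw [map_mul, map_prod, ← AlgHom.comp_apply, comp_aeval]
  simp only [hG, map_pow, aeval_X]
  rw [aeval_mul_of_isHomogeneous (hW m), aeval_X_left_apply]
  ring

/-- The polynomials that are homogeneous in `T` and vanish under `T ↦ F(X)`. -/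
theorem pencil_dvd_of_substT_eq_zero (hF0 : F 0 ≠ 0) (hF : IsRelPrime (F 0) (F 1)) :
    ∀ (i : ℕ) (W : TXPoly K), (∀ m, (coeff m W).IsHomogeneous i) → substT F W = 0 →
      pencil F ∣ W := by
  intro i
  induction i with
  | zero =>
    intro W hW h
    obtain ⟨w, rfl⟩ := eq_inX_of_coeff_isHomogeneous_zero hW
    rw [substT_inX] at h
    simp [h]
  | succ i ih =>
    intro W hW h
    obtain ⟨V, w, hV, rfl, -⟩ := exists_eq_T_zero_mul_add (j := 0) hW
    rw [map_add, map_mul, map_mul, map_pow, substT_T, substT_T, substT_inX] at h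
    -- The hypothesis reads F₁ · V(F, X) + w · F₂^(i + 1) = 0 in the notation of the theorem, and
    -- the two forms are coprime.
    obtain ⟨v, rfl⟩ : F 0 ∣ w := by
      refine (hF.pow_right (n := i + 1)).dvd_of_dvd_mul_right ?_
      rw [eq_neg_of_add_eq_zero_right h]
      exact (Dvd.intro _ rfl : F 0 ∣ F 0 * _).neg_right
    have h1 : pencil F ∣ V + inX (F 1) * inX v * T 1 ^ i := by
      refine ih _ (fun m => ?_) ?_
      · rw [coeff_add]
        refine (hV m).add ?_
        rw [← map_mul inX, T, ← C_pow, mul_comm, coeff_C_mul, inX, coeff_map]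
        simpa using (isHomogeneous_X_pow (R := K) (1 : Fin 2) i).mul (isHomogeneous_C _ _)
      · refine (mul_eq_zero.1 ?_).resolve_left hF0
        rw [← h, map_add, map_mul, map_mul, map_pow, substT_T, substT_inX, substT_inX]
        ring
    -- Modulo the pencil, `T 1 * inX (F 0)` may be replaced by `T 0 * inX (F 1)`; this makes `T 0` a
    -- factor and leaves a polynomial of smaller T-degree.
    have h2 : T 0 * V + inX (F 0 * v) * T 1 ^ (i + 1) =
        T 0 * (V + inX (F 1) * inX v * T 1 ^ i) - pencil F * (inX v * T 1 ^ i) := by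
      rw [pencil, map_mul]
      ring
    rw [h2]
    exact dvd_sub (h1.mul_left _) (Dvd.intro _ rfl)

/-! ### Membership in the moving curve ideal -/

/-- The exponent of Z records the X-degree. The kernel is therefore described by the vanishing of
every X-homogeneous component at X = u. -/
theorem coeff_reesMap (W : TXPoly K) (n : ℕ) :
    (reesMap u W : Polynomial (TPoly K)).coeff n = aeval u (homogeneousComponent n W) := by
  have h1 : (reesMap u W : Polynomial (TPoly K)) =
      aeval (fun s => Polynomial.C (u s) * Polynomial.X) W := by
    have : (reesAlgebra (paramIdeal u)).val.comp (reesMap u) =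
        aeval (fun s => Polynomial.C (u s) * Polynomial.X) := by
      ext s : 1
      simp [reesMap, Polynomial.C_mul_X_eq_monomial]
    rw [← this]
    rfl
  have h2 : ∀ m, aeval (fun s => Polynomial.C (u s) * Polynomial.X) (homogeneousComponent m W) =
      Polynomial.C (aeval u (homogeneousComponent m W)) * Polynomial.X ^ m := by
    intro m
    rw [aeval_mul_of_isHomogeneous (homogeneousComponent_isHomogeneous m W)]
    congr 1
    exact (aeval_algebraMap_apply (Polynomial (TPoly K)) u _)
  rw [h1]
  conv_lhs => rw [← sum_homogeneousComponent W, map_sum]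
  simp only [h2, Polynomial.finsetSum_coeff, Polynomial.coeff_C_mul_X_pow]
  rw [Finset.sum_ite_eq]
  split_ifs with h
  · rfl
  · rw [homogeneousComponent_eq_zero _ _ (by simpa using h), map_zero]

theorem mem_movingCurveIdeal_iff :
    W ∈ movingCurveIdeal u ↔ ∀ n, aeval u (homogeneousComponent n W) = 0 := by
  simp only [movingCurveIdeal, RingHom.mem_ker, ← coeff_reesMap]
  rw [← Subtype.coe_injective.eq_iff, Polynomial.ext_iff]
  simp

theorem IsBihomogeneous.mem_movingCurveIdeal_iff (hW : IsBihomogeneous W i j) :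
    W ∈ movingCurveIdeal u ↔ aeval u W = 0 := by
  classical
  rw [ConicCurve.mem_movingCurveIdeal_iff]
  constructor
  · intro h
    rw [← homogeneousComponent_eq_self hW.1, h]
  · intro h n
    rw [homogeneousComponent_of_mem hW.1]
    split_ifs
    · exact h
    · exact map_zero _

theorem isHomogeneous_aeval (hu : ∀ s, (u s).IsHomogeneous d) (hW : IsBihomogeneous W i j) :
    (aeval u W).IsHomogeneous (i + d * j) := by
  rw [aeval_eq_sum]
  refine IsHomogeneous.sum _ _ _ fun m hm => (hW.2 m).mul ?_
  have h1 : m.degree = j := by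
    by_contra hne
    exact mem_support_iff.1 hm (hW.1.coeff_eq_zero hne)
  rw [← h1, Finsupp.degree_eq_sum, Finset.mul_sum]
  exact IsHomogeneous.prod _ _ _ fun s _ => (hu s).pow _

/-- All `u s` have degree d, so the part of T-degree i within X-degree j contributes exactly the
part of degree dj + i of the value at X = u. Thus the ideal is bihomogeneous. -/
theorem bihomogeneousComponent_mem_movingCurveIdeal (hu : ∀ s, (u s).IsHomogeneous d)
    (hW : W ∈ movingCurveIdeal u) (i j : ℕ) :
    bihomogeneousComponent i j W ∈ movingCurveIdeal u := by
  classical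
  rw [(isBihomogeneous_bihomogeneousComponent i j W).mem_movingCurveIdeal_iff]
  have h1 : aeval u (bihomogeneousComponent i j W) =
      homogeneousComponent (d * j + i) (aeval u (homogeneousComponent j W)) := by
    rw [homogeneousComponent_apply j W, bihomogeneousComponent, map_sum, map_sum, map_sum,
      Finset.sum_filter]
    refine Finset.sum_congr rfl fun m _ => ?_
    split_ifs with h
    · have h2 : (∏ s, u s ^ m s).IsHomogeneous (d * j) := by
        rw [← h, Finsupp.degree_eq_sum, Finset.mul_sum]
        exact IsHomogeneous.prod _ _ _ fun s _ => (hu s).pow _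
      rw [aeval_monomial, aeval_monomial, Finsupp.prod_fintype _ _ (by simp), mul_comm,
        mul_comm (algebraMap _ _ (coeff m W))]
      exact (homogeneousComponent_mul_left h2 i).symm
    · simp
  rw [h1, mem_movingCurveIdeal_iff.1 hW j, map_zero]

end Substitution

/-! ### From rational maps to polynomial identities -/

section Maps

variable {K : Type*} [Field K]

theorem MapsTo.exists_rep_eq {σ ι : Type*} {f : ι → MvPolynomial σ K} {x : ℙ K (σ → K)}
    {y : ℙ K (ι → K)} (h : MapsTo f x y) :
    ∃ c : K, c ≠ 0 ∧ y.rep = c • fun i => eval x.rep (f i) := by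
  obtain ⟨h0, rfl⟩ := h
  obtain ⟨c, hc⟩ := Projectivization.exists_smul_eq_mk_rep K _ h0
  exact ⟨c, c.ne_zero, hc.symm⟩

theorem eval_aeval_eq {σ ι : Type*} (u : ι → MvPolynomial σ K) (f : MvPolynomial ι K) (t : σ → K) :
    eval t (aeval u f) = eval (fun i => eval t (u i)) f := by
  change aeval t (aeval u f) = aeval (fun i => aeval t (u i)) f
  rw [← AlgHom.comp_apply, comp_aeval]

variable {E : XPoly K} {F L : Fin 2 → XPoly K} {u : Fin 3 → TPoly K} {n n' d e : ℕ}

/-- The scalar comes from the representatives chosen for x and t; the one for x enters with the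
power n, the degree of the forms F. -/
theorem exists_eval_eq_smul {t : ℙ K (Fin 2 → K)} {x : ℙ K (Fin 3 → K)}
    (hF : ∀ i, (F i).IsHomogeneous n) (h1 : MapsTo u t x) (h2 : MapsTo F x t) :
    ∃ c : K, c ≠ 0 ∧ ∀ i, eval t.rep (aeval u (F i)) = c * t.rep i := by
  obtain ⟨a, ha, hx⟩ := h1.exists_rep_eq
  obtain ⟨b, hb, ht⟩ := h2.exists_rep_eq
  refine ⟨(b * a ^ n)⁻¹, inv_ne_zero (mul_ne_zero hb (pow_ne_zero _ ha)), fun i => ?_⟩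
  have h := congrFun ht i
  rw [hx, Pi.smul_apply, eval_smul_of_isHomogeneous (hF i), ← eval_aeval_eq] at h
  rw [h, smul_eq_mul]
  field_simp

/-- The pair `F` recovers the parameter. -/
theorem IsParameterizedBy.exists_aeval_eq [Infinite K] (h : IsParameterizedBy E n F d u) :
    ∃ G : TPoly K, G ≠ 0 ∧ ∀ i, aeval u (F i) = X i * G := by
  have hFu : ∀ i, (aeval u (F i)).IsHomogeneous (d * n) := fun i =>
    IsHomogeneous.aeval (h.F_homogeneous i) u h.u_homogeneous
  -- F(u(t)) is proportional to t for almost all t, so this minor vanishes almost everywhere and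
  -- hence identically.
  have h1 : aeval u (F 0) * X 1 - aeval u (F 1) * X 0 = 0 := by
    refine eq_zero_of_finite_nonzeros
      (((hFu 0).mul (isHomogeneous_X K 1)).sub ((hFu 1).mul (isHomogeneous_X K 0)))
      (h.psi_phi.subset ?_)
    rintro t ht ⟨x, hx1, hx2⟩
    obtain ⟨c, -, hc⟩ := exists_eval_eq_smul h.F_homogeneous hx1 hx2
    refine ht ?_
    rw [map_sub, map_mul, map_mul, hc, hc, eval_X, eval_X]
    ring
  have hX : ¬ (X 0 : TPoly K) ∣ X 1 := by simp [X_dvd_X]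
  obtain ⟨G, hG⟩ : (X 0 : TPoly K) ∣ aeval u (F 0) := by
    refine ((X_prime (R := K) (i := (0 : Fin 2))).dvd_or_dvd ?_).resolve_right hX
    rw [sub_eq_zero.1 h1]
    exact Dvd.intro_left _ rfl
  have hG1 : aeval u (F 1) = X 1 * G := by
    refine mul_right_cancel₀ (X_ne_zero (R := K) (0 : Fin 2)) ?_
    rw [← sub_eq_zero.1 h1, hG]
    ring
  have hGi : ∀ i, aeval u (F i) = X i * G := Fin.forall_fin_two.2 ⟨hG, hG1⟩
  refine ⟨G, ?_, hGi⟩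
  rintro rfl
  obtain ⟨t, -, ht⟩ := ((infinite_projectiveLine K).sdiff h.psi_phi).nonempty
  obtain ⟨x, hx1, hx2⟩ := not_not.1 ht
  obtain ⟨c, hc0, hc⟩ := exists_eval_eq_smul h.F_homogeneous hx1 hx2
  refine t.rep_nonzero (funext fun i => ?_)
  have := hc i
  rw [hGi, mul_zero, map_zero] at this
  simpa [hc0] using this.symm

/-- By `psi_phi` the map φ is defined at almost all points, and there its value lies on the curve.
-/
theorem IsParameterizedBy.aeval_eq_zero [Infinite K] (h : IsParameterizedBy E n F d u)
    (hE : E.IsHomogeneous e) : aeval u E = 0 := by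
  refine eq_zero_of_finite_nonzeros (IsHomogeneous.aeval hE u h.u_homogeneous)
    (h.psi_phi.subset ?_)
  rintro t ht ⟨x, hx, -⟩
  refine ht ?_
  obtain ⟨c, hc, hr⟩ := hx.exists_rep_eq
  have h1 : eval x.rep E = 0 := h.maps_into t x hx
  rw [hr, eval_smul_of_isHomogeneous hE] at h1
  rw [eval_aeval_eq]
  exact (mul_eq_zero.1 h1).resolve_left (pow_ne_zero _ hc)

/-- Any pair of forms that recovers the parameter gives the inverse of the parameterization. -/
theorem IsParameterizedBy.of_aeval_eq (h : IsParameterizedBy E n F d u)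
    (hL : ∀ i, (L i).IsHomogeneous n') (hLc : NoCommonFactor L) {g : TPoly K} (hg0 : g ≠ 0)
    (hg : ∀ i, aeval u (L i) = X i * g) : IsParameterizedBy E n' L d u := by
  have hzero : {t : ℙ K (Fin 2 → K) | eval t.rep g = 0}.Finite := by
    refine (finite_zeros (IsHomogeneous.aeval (hL 0) u h.u_homogeneous)
      (by rw [hg]; exact mul_ne_zero (X_ne_zero _) hg0)).subset fun t ht => ?_
    have ht' : eval t.rep g = 0 := ht
    change eval t.rep (aeval u (L 0)) = 0
    rw [hg, map_mul, ht', mul_zero]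
  have hmaps : ∀ t x, MapsTo u t x → eval t.rep g ≠ 0 → MapsTo L x t := by
    intro t x hx ht
    obtain ⟨c, hc, hr⟩ := hx.exists_rep_eq
    have h1 : (fun i => eval x.rep (L i)) = (c ^ n' * eval t.rep g) • t.rep := by
      funext i
      rw [hr, eval_smul_of_isHomogeneous (hL i), ← eval_aeval_eq, hg, map_mul, eval_X,
        Pi.smul_apply, smul_eq_mul]
      ring
    have h2 : c ^ n' * eval t.rep g ≠ 0 := mul_ne_zero (pow_ne_zero _ hc) ht
    have h3 : (fun i => eval x.rep (L i)) ≠ 0 := by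
      rw [h1]
      exact smul_ne_zero h2 t.rep_nonzero
    refine ⟨h3, ?_⟩
    conv_rhs => rw [← t.mk_rep]
    rw [Projectivization.mk_eq_mk_iff']
    exact ⟨_, h1.symm⟩
  refine ⟨hL, hLc, h.u_homogeneous, h.u_noCommonFactor, h.maps_into, ?_, ?_⟩
  · refine (h.psi_phi.union hzero).subset fun t ht => ?_
    by_contra hcon
    simp only [Set.mem_union, Set.mem_ofPred_eq, not_or, not_not] at hcon
    obtain ⟨⟨x, hx, -⟩, hgt⟩ := hcon
    exact ht ⟨x, hx, hmaps t x hx hgt⟩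
  · have hfin : (⋃ t ∈ {t : ℙ K (Fin 2 → K) | eval t.rep g = 0}, {x | MapsTo u t x}).Finite :=
      hzero.biUnion fun t _ => Set.Subsingleton.finite <| by
        rintro x ⟨_, rfl⟩ y ⟨_, rfl⟩
        rfl
    refine (h.phi_psi.union hfin).subset fun x hx => ?_
    by_contra hcon
    rw [Set.mem_union, not_or] at hcon
    obtain ⟨h1, h2⟩ := hcon
    obtain ⟨t, -, ht⟩ : ∃ t, MapsTo F x t ∧ MapsTo u t x := by
      by_contra h3
      exact h1 ⟨hx.1, h3⟩
    refine hx.2 ⟨t, hmaps t x ht fun hgt => h2 ?_, ht⟩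
    exact Set.mem_biUnion (by exact hgt) ht

theorem isRelPrime_of_noCommonFactor (h : NoCommonFactor F) : IsRelPrime (F 0) (F 1) :=
  fun g h0 h1 => h g (Fin.forall_fin_two.2 ⟨h0, h1⟩)

theorem ne_zero_of_noCommonFactor (h : NoCommonFactor F) (hF : ∀ i, (F i).IsHomogeneous (n + 1)) :
    F 0 ≠ 0 := by
  intro h0
  have h1 : IsUnit (F 1) := h _ (Fin.forall_fin_two.2 ⟨h0 ▸ dvd_zero _, dvd_rfl⟩)
  have h2 : (1 : XPoly K) = 0 :=
    eq_zero_of_dvd_of_degree_lt (hF 1) (isHomogeneous_one _ _) h1.dvd (Nat.succ_pos n)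
  exact one_ne_zero h2

end Maps

/-! ### Moving lines and moving conics of low degree -/

/-- The forms `u` of degree `d` parameterize a plane curve, and the quadratic forms `F` recover the
parameter. -/
structure RecoversParameter {K : Type*} [Field K] (u : Fin 3 → TPoly K) (F : Fin 2 → XPoly K)
    (G : TPoly K) (d : ℕ) : Prop where
  pos : 0 < d
  u_homogeneous : ∀ s, (u s).IsHomogeneous d
  u_noCommonFactor : NoCommonFactor u
  F_homogeneous : ∀ s, (F s).IsHomogeneous 2
  F_noCommonFactor : NoCommonFactor F
  ne_zero : G ≠ 0
  aeval_eq : ∀ s, aeval u (F s) = X s * G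

section

variable {K : Type*} [Field K] {u : Fin 3 → TPoly K} {F : Fin 2 → XPoly K}
  {G : TPoly K} {d i j : ℕ} {W : TXPoly K}

theorem coeff_movingLine (a : Fin 3 → TPoly K) (s : Fin 3) :
    coeff (Finsupp.single s 1) (movingLine a) = a s := by
  classical
  simp only [movingLine, coeff_sum, coeff_C_mul, coeff_X, mul_ite, mul_one, mul_zero]
  rw [Finset.sum_eq_single s]
  · simp
  · intro b _ hb
    rw [if_neg]
    intro h
    exact hb (Finsupp.single_left_injective one_ne_zero h)
  · simp

theorem movingLine_injective : Function.Injective (movingLine : (Fin 3 → TPoly K) → TXPoly K) :=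
  fun a b h => funext fun s => by rw [← coeff_movingLine a s, h, coeff_movingLine]

theorem movingLine_zero : movingLine (0 : Fin 3 → TPoly K) = 0 := by simp [movingLine]

namespace RecoversParameter

theorem degree_le [Infinite K] (h : RecoversParameter u F G d) {H : XPoly K} {n : ℕ}
    (hH : H.IsHomogeneous n) (hH0 : H ≠ 0) (hHu : aeval u H = 0) : d ≤ n := by
  obtain ⟨D, rfl⟩ := Nat.exists_eq_succ_of_ne_zero h.pos.ne'
  exact le_degree_of_vanishes h.u_homogeneous h.u_noCommonFactor h.F_homogeneous h.aeval_eq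
    h.ne_zero hH hH0 hHu

theorem dvd_of_aeval_eq_zero [Infinite K] (h : RecoversParameter u F G d) {E H : XPoly K} {e n : ℕ}
    (hE : Irreducible E) (hEh : E.IsHomogeneous e) (hEu : aeval u E = 0)
    (hH : H.IsHomogeneous n) (hHu : aeval u H = 0) : E ∣ H := by
  obtain ⟨D, rfl⟩ := Nat.exists_eq_succ_of_ne_zero h.pos.ne'
  exact dvd_of_vanishes h.u_homogeneous h.u_noCommonFactor h.F_homogeneous h.aeval_eq
    h.ne_zero hE hEh hEu hH hHu

theorem pencil_dvd (h : RecoversParameter u F G d) (hW : IsBihomogeneous W i j)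
    (h0 : substT F W = 0) : pencil F ∣ W :=
  pencil_dvd_of_substT_eq_zero (ne_zero_of_noCommonFactor h.F_noCommonFactor h.F_homogeneous)
    (isRelPrime_of_noCommonFactor h.F_noCommonFactor) i W hW.2 h0

theorem aeval_substT_eq_zero_iff (h : RecoversParameter u F G d) (hW : IsBihomogeneous W i j) :
    aeval u (substT F W) = 0 ↔ aeval u W = 0 := by
  rw [aeval_substT h.aeval_eq hW.2, mul_eq_zero, or_iff_left (pow_ne_zero _ h.ne_zero)]

/-- There are no moving curves of low bidegree that follow `u`. -/
theorem eq_zero_of_aeval_eq_zero [Infinite K] (h : RecoversParameter u F G d)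
    (hW : IsBihomogeneous W i j) (hj : j < 2) (hij : 2 * i + j < d) (hWu : aeval u W = 0) :
    W = 0 := by
  have h1 : substT F W = 0 := by
    by_contra hne
    have := h.degree_le (hW.substT h.F_homogeneous) hne ((h.aeval_substT_eq_zero_iff hW).2 hWu)
    omega
  -- The pencil has X-degree 2, which exceeds j.
  exact eq_zero_of_dvd_of_degree_lt (isBihomogeneous_pencil h.F_homogeneous).1 hW.1
    (h.pencil_dvd hW h1) hj

theorem syzygy_eq_zero [Infinite K] (h : RecoversParameter u F G d) {a : Fin 3 → TPoly K}
    (ha : ∀ s, (a s).IsHomogeneous i) (hi : 2 * i + 1 < d) (hau : ∑ s, a s * u s = 0) :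
    a = 0 := by
  refine movingLine_injective ?_
  rw [movingLine_zero]
  exact h.eq_zero_of_aeval_eq_zero (isBihomogeneous_movingLine ha) one_lt_two hi
    (by rw [aeval_movingLine, hau])

end RecoversParameter

/-- The map `(a₁, a₂, a₃) ↦ a₁ u₁ + a₂ u₂ + a₃ u₃` on triples of forms of degree `i`. -/
def combinationMap (hu : ∀ s, (u s).IsHomogeneous d) (i : ℕ) :
    (Fin 3 → homogeneousSubmodule (Fin 2) K i) →ₗ[K] homogeneousSubmodule (Fin 2) K (i + d) where
  toFun a := ⟨∑ s, (a s).1 * u s, Submodule.sum_mem _ fun s _ => (a s).2.mul (hu s)⟩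
  map_add' a b := Subtype.ext (by simp [add_mul, Finset.sum_add_distrib])
  map_smul' c a := Subtype.ext (by simp [Finset.smul_sum])

theorem finrank_triples (i : ℕ) :
    finrank K (Fin 3 → homogeneousSubmodule (Fin 2) K i) = 3 * (i + 1) := by
  rw [finrank_pi_fintype]
  simp [finrank_forms K 1]

theorem finrank_binary_forms (i : ℕ) :
    finrank K (homogeneousSubmodule (Fin 2) K i) = i + 1 := by
  simp [finrank_forms K 1]

/-- A moving curve that follows `u`, written in terms of `T₁` and `T₂`. -/
theorem exists_eq_mul_T_add_of_aeval_eq_zero {m : ℕ} (hu : ∀ s, (u s).IsHomogeneous d)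
    (hW : IsBihomogeneous W (i + 1) j) (hWu : aeval u W = 0) (hm : i + d * j = m + 1) :
    ∃ (A B : TXPoly K) (g : TPoly K), IsBihomogeneous A i j ∧ IsBihomogeneous B i j ∧
      g.IsHomogeneous m ∧ W = A * T 0 + B * T 1 ∧ aeval u A = X 1 * g ∧ aeval u B = -(X 0 * g) := by
  obtain ⟨A, B, hA, hB, rfl⟩ := hW.exists_eq_mul_T_add
  rw [map_add, map_mul, map_mul, aeval_T, aeval_T] at hWu
  have hX : ¬ (X 1 : TPoly K) ∣ X 0 := by simp [X_dvd_X]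
  -- From A(T, u) T₁ + B(T, u) T₂ = 0. The quotient g is the obstruction to A and B following u
  -- themselves.
  have hdvd : (X 1 : TPoly K) ∣ aeval u A := by
    refine ((X_prime (R := K) (i := (1 : Fin 2))).dvd_or_dvd ?_).resolve_right hX
    rw [eq_neg_of_add_eq_zero_left hWu]
    exact (Dvd.intro_left _ rfl).neg_right
  have hAh := isHomogeneous_aeval hu hA
  rw [hm, add_comm m 1] at hAh
  obtain ⟨g, hg, hgA⟩ := exists_form_of_dvd (isHomogeneous_X K (1 : Fin 2)) hAh hdvd
  refine ⟨A, B, g, hA, hB, hg, rfl, hgA, mul_right_cancel₀ (X_ne_zero (R := K) (1 : Fin 2)) ?_⟩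
  rw [eq_neg_of_add_eq_zero_right hWu, hgA]
  ring

namespace RecoversParameter

/-- A curve that is parameterized by forms of degree two is parameterizable by lines. -/
theorem exists_lines [Infinite K] (h : RecoversParameter u F G 2) :
    ∃ (L : Fin 2 → XPoly K) (g : TPoly K), (∀ s, (L s).IsHomogeneous 1) ∧ NoCommonFactor L ∧
      g ≠ 0 ∧ ∀ s, aeval u (L s) = X s * g := by
  -- Triples of linear forms have dimension 6 and are mapped to cubic forms, of dimension 4. The
  -- resulting moving line A T₁ + B T₂ has A(u) = T₂ g and B(u) = -T₁ g, so (-B : A) recovers the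
  -- parameter.
  obtain ⟨a, ha, ha0⟩ : ∃ a, combinationMap h.u_homogeneous 1 a = 0 ∧ a ≠ 0 := by
    obtain ⟨a, h1, h2⟩ := Submodule.exists_mem_ne_zero_of_ne_bot
      (LinearMap.ker_ne_bot_of_finrank_lt (f := combinationMap h.u_homogeneous 1)
        (by rw [finrank_triples, finrank_binary_forms]; norm_num))
    exact ⟨a, h1, h2⟩
  have hau : aeval u (movingLine fun s => (a s).1) = 0 := by
    rw [aeval_movingLine]
    exact congrArg Subtype.val ha
  obtain ⟨A, B, g, hA, hB, -, hW, hAg, hBg⟩ := exists_eq_mul_T_add_of_aeval_eq_zero (i := 0)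
    (m := 1) h.u_homogeneous (isBihomogeneous_movingLine fun s => (a s).2) hau rfl
  obtain ⟨A, rfl⟩ := eq_inX_of_coeff_isHomogeneous_zero hA.2
  obtain ⟨B, rfl⟩ := eq_inX_of_coeff_isHomogeneous_zero hB.2
  -- A does not involve T, so any substitution for T returns A; zero is an arbitrary choice.
  have hA' : A.IsHomogeneous 1 := by
    simpa [substT_inX] using hA.substT (F := 0) (n := 1) fun s => isHomogeneous_zero _ _ _
  have hB' : B.IsHomogeneous 1 := by
    simpa [substT_inX] using hB.substT (F := 0) (n := 1) fun s => isHomogeneous_zero _ _ _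
  rw [aeval_inX] at hAg hBg
  have hg0 : g ≠ 0 := by
    rintro rfl
    rw [mul_zero] at hAg hBg
    rw [neg_zero] at hBg
    have h1 : inX A = 0 := h.eq_zero_of_aeval_eq_zero hA one_lt_two (by norm_num)
      (by rw [aeval_inX, hAg])
    have h2 : inX B = 0 := h.eq_zero_of_aeval_eq_zero hB one_lt_two (by norm_num)
      (by rw [aeval_inX, hBg])
    rw [h1, h2, zero_mul, zero_mul, add_zero, ← movingLine_zero] at hW
    exact ha0 (funext fun s => Subtype.ext (congrFun (movingLine_injective hW) s))
  have hL : ∀ s, aeval u (![-B, A] s) = X s * g :=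
    Fin.forall_fin_two.2 ⟨(map_neg (aeval u) B).trans (by rw [hBg, neg_neg]), hAg⟩
  have hL0 : ∀ s, ![-B, A] s ≠ 0 := fun s h0 => by
    have := hL s
    rw [h0, map_zero] at this
    exact mul_ne_zero (X_ne_zero s) hg0 this.symm
  have hLh : ∀ s, (![-B, A] s).IsHomogeneous 1 := Fin.forall_fin_two.2 ⟨hB'.neg, hA'⟩
  refine ⟨![-B, A], g, hLh, fun p hp => ?_, hg0, hL⟩
  obtain ⟨m, hm⟩ := hp 0
  obtain ⟨n, hn⟩ := hp 1
  have hp0 : p ≠ 0 := by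
    rintro rfl
    exact hL0 0 (by rw [hm, zero_mul])
  have hm0 : m ≠ 0 := by
    rintro rfl
    exact hL0 0 (by rw [hm, mul_zero])
  have hn0 : n ≠ 0 := by
    rintro rfl
    exact hL0 1 (by rw [hn, mul_zero])
  have hdm := totalDegree_mul_of_isDomain hp0 hm0
  have hdn := totalDegree_mul_of_isDomain hp0 hn0
  rw [← hm, (hLh 0).totalDegree (hL0 0)] at hdm
  rw [← hn, (hLh 1).totalDegree (hL0 1)] at hdn
  -- A common factor of degree 1 would make both linear forms constant multiples of it, so their
  -- values `X 0 * g` and `X 1 * g` would be proportional over `K`.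
  by_cases hp1 : p.totalDegree = 0
  · rw [totalDegree_eq_zero_iff_eq_C.1 hp1] at hp0 ⊢
    refine (isUnit_iff_ne_zero.2 fun h0 => ?_).map C
    rw [h0, C_0] at hp0
    exact hp0 rfl
  · exfalso
    have hmC := totalDegree_eq_zero_iff_eq_C.1 (by omega : m.totalDegree = 0)
    have hnC := totalDegree_eq_zero_iff_eq_C.1 (by omega : n.totalDegree = 0)
    have h1 : aeval u (![-B, A] 0 * n - ![-B, A] 1 * m) = 0 := by
      rw [hm, hn]
      simp only [map_sub, map_mul]
      ring
    rw [map_sub, map_mul, map_mul, hL, hL, hmC, hnC, aeval_C, aeval_C] at h1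
    have h2 : (X 0 * C (coeff 0 n) - X 1 * C (coeff 0 m) : TPoly K) = 0 := by
      refine mul_right_cancel₀ hg0 ?_
      rw [zero_mul, ← h1]
      change _ = X 0 * g * C (coeff 0 n) - X 1 * g * C (coeff 0 m)
      ring
    have h3 := congrArg (eval ![(1 : K), 0]) h2
    simp only [map_sub, map_mul, eval_X, eval_C, map_zero, Matrix.cons_val_zero,
      Matrix.cons_val_one, one_mul, zero_mul, sub_zero] at h3
    exact hn0 (by rw [hnC, h3, C_0])

end RecoversParameter

/-- Moving conics of degree `i` in `T`, given by their coefficients. -/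
def conicOfCoeffs (K : Type*) [Field K] (i : ℕ) :
    (exponents 3 2 → homogeneousSubmodule (Fin 2) K i) →ₗ[K] TXPoly K where
  toFun f := ∑ m, monomial m.1 (f m).1
  map_add' f g := by
    rw [← Finset.sum_add_distrib]
    exact Finset.sum_congr rfl fun m _ => map_add _ _ _
  map_smul' c f := by
    rw [RingHom.id_apply, Finset.smul_sum]
    exact Finset.sum_congr rfl fun m _ => (smul_monomial c).symm

theorem conicOfCoeffs_injective (i : ℕ) : Function.Injective (conicOfCoeffs K i) := by
  intro f g h
  funext m
  have key : ∀ f, coeff m.1 (conicOfCoeffs K i f) = (f m).1 := by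
    intro f
    change coeff m.1 (∑ m, monomial m.1 (f m).1) = (f m).1
    simp only [coeff_sum, coeff_monomial]
    rw [Finset.sum_eq_single m]
    · simp
    · intro b _ hb
      exact if_neg fun h => hb (Subtype.ext h)
    · simp
  exact Subtype.ext (by rw [← key, h, key])

theorem isBihomogeneous_conicOfCoeffs (f : exponents 3 2 → homogeneousSubmodule (Fin 2) K i) :
    IsBihomogeneous (conicOfCoeffs K i f) i 2 :=
  IsBihomogeneous.sum _ fun m _ => isBihomogeneous_monomial (f m).2 (mem_exponents.1 m.2)

/-- There is a moving conic that is not a multiple of the pencil. -/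
theorem exists_isExtraConic {k : ℕ} (hu : ∀ s, (u s).IsHomogeneous (2 * (k + 2)))
    (hF : ∀ s, (F s).IsHomogeneous 2) : ∃ Q, IsExtraConic u F (k + 2) Q := by
  let Λ : (exponents 3 2 → homogeneousSubmodule (Fin 2) K (k + 1)) →ₗ[K]
      homogeneousSubmodule (Fin 2) K (k + 1 + 2 * (k + 2) * 2) :=
    LinearMap.codRestrict _
      (((aeval u : TXPoly K →ₐ[TPoly K] TPoly K).restrictScalars K).toLinearMap.comp
        (conicOfCoeffs K (k + 1)))
      fun f => isHomogeneous_aeval hu (isBihomogeneous_conicOfCoeffs f)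
  have h1 := Λ.finrank_range_add_finrank_ker
  have h2 := (LinearMap.range Λ).finrank_le
  rw [finrank_binary_forms] at h2
  rw [finrank_pi_fintype, Finset.sum_const, finrank_binary_forms, Finset.card_univ,
    Fintype.card_coe, card_exponents, smul_eq_mul] at h1
  have h6 : (2 + 2).choose 2 = 6 := rfl
  rw [h6] at h1
  let M : TPoly K →ₗ[K] TXPoly K := (LinearMap.mulRight K (pencil F)).comp
    (IsScalarTower.toAlgHom K (TPoly K) (TXPoly K)).toLinearMap
  have h3 := Submodule.finrank_map_le M (homogeneousSubmodule (Fin 2) K k)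
  rw [finrank_binary_forms] at h3
  have h4 := ((LinearMap.ker Λ).equivMapOfInjective _ (conicOfCoeffs_injective (k + 1))).finrank_eq
  -- The conics have 6(k + 2) coefficients and satisfy at most 5k + 10 conditions, so the kernel has
  -- dimension at least k + 2; the multiples of the pencil have dimension at most k + 1.
  obtain ⟨_, ⟨f, hf, rfl⟩, hQ⟩ : ∃ Q ∈ (LinearMap.ker Λ).map (conicOfCoeffs K (k + 1)),
      Q ∉ (homogeneousSubmodule (Fin 2) K k).map M := by
    by_contra! hle
    have := Submodule.finrank_mono (show (LinearMap.ker Λ).map (conicOfCoeffs K (k + 1)) ≤ _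
      from hle)
    omega
  have hb := isBihomogeneous_conicOfCoeffs f
  refine ⟨conicOfCoeffs K (k + 1) f, ?_, hb, fun hspan => hQ ?_⟩
  · rw [hb.mem_movingCurveIdeal_iff]
    exact congrArg Subtype.val hf
  · obtain ⟨V, hV⟩ := Ideal.mem_span_singleton.1 hspan
    have h5 := bihomogeneousComponent_mul (isBihomogeneous_pencil hF) k 0 V
    rw [← hV, add_comm 1 k, hb.component_eq] at h5
    have h6 := isBihomogeneous_bihomogeneousComponent k 0 V
    refine ⟨coeff 0 (bihomogeneousComponent k 0 V), h6.2 0, ?_⟩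
    rw [h5, mul_comm, eq_C_of_isHomogeneous_zero h6.1]
    simp [M, algebraMap_eq]

end

/-! ### Bases of the syzygy module -/

section Parallel

variable {K : Type*} [Field K]

/-- Each irreducible factor of p fails to divide some `u i`, hence divides x, and can be cancelled
from both sides. -/
theorem dvd_of_dvd_mul_of_noCommonFactor {σ ι : Type*} {u : ι → MvPolynomial σ K}
    (hu : NoCommonFactor u) (p : MvPolynomial σ K) :
    ∀ x : MvPolynomial σ K, (∀ i, p ∣ x * u i) → p ∣ x := by
  induction p using WfDvdMonoid.induction_on_irreducible with
  | zero =>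
    intro x h
    obtain ⟨i, hi⟩ : ∃ i, u i ≠ 0 := by
      by_contra! h0
      exact not_isUnit_zero (hu 0 fun i => by simp [h0 i])
    have := zero_dvd_iff.1 (h i)
    rw [(mul_eq_zero.1 this).resolve_right hi]
  | unit p hp => exact fun x _ => hp.dvd
  | mul q p hq hp ih =>
    intro x h
    obtain ⟨i, hi⟩ : ∃ i, ¬ p ∣ u i := by
      by_contra! h0
      exact hp.not_isUnit (hu p h0)
    obtain ⟨y, rfl⟩ : p ∣ x := (hp.prime.dvd_or_dvd ((Dvd.intro _ rfl).trans (h i))).resolve_right hi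
    refine mul_dvd_mul_left p (ih y fun i => ?_)
    have := h i
    rw [mul_assoc] at this
    exact (mul_dvd_mul_iff_left hp.ne_zero).1 this

/-- A nonzero `u i` divides `z i * u j` for all j, hence divides `z i`; the quotient then serves all
indices. -/
theorem exists_eq_mul_of_parallel {σ ι : Type*} {u z : ι → MvPolynomial σ K}
    (hu : NoCommonFactor u) (h : ∀ i j, z i * u j = z j * u i) :
    ∃ x, ∀ i, z i = x * u i := by
  obtain ⟨i, hi⟩ : ∃ i, u i ≠ 0 := by
    by_contra! h0
    exact not_isUnit_zero (hu 0 fun i => by simp [h0 i])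
  obtain ⟨x, hx⟩ := dvd_of_dvd_mul_of_noCommonFactor hu (u i) (z i) fun j => by
    rw [h i j]
    exact Dvd.intro_left _ rfl
  refine ⟨x, fun j => mul_right_cancel₀ hi ?_⟩
  rw [h j i, hx]
  ring

/-- Both a and b are orthogonal to u, hence their cross product is parallel to u; the minors express
this without division. -/
theorem cross_parallel {R : Type*} [CommRing R] {a b u : Fin 3 → R} (ha : ∑ s, a s * u s = 0)
    (hb : ∑ s, b s * u s = 0) (i j : Fin 3) :
    crossProduct a b i * u j = crossProduct a b j * u i := by
  rw [Fin.sum_univ_three] at ha hb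
  rw [cross_apply]
  fin_cases i <;> fin_cases j <;> simp
  · linear_combination b 2 * ha - a 2 * hb
  · linear_combination a 1 * hb - b 1 * ha
  · linear_combination a 2 * hb - b 2 * ha
  · linear_combination b 0 * ha - a 0 * hb
  · linear_combination b 1 * ha - a 1 * hb
  · linear_combination a 0 * hb - b 0 * ha

/-- A vector parallel to both of two non-parallel vectors is zero: every product of a coordinate of
v with a coordinate of a × b is a combination of coordinates of v × b and a × v. -/
theorem eq_zero_of_cross_eq_zero {R : Type*} [CommRing R] [IsDomain R] {a b v : Fin 3 → R}
    (hab : crossProduct a b ≠ 0) (hv : crossProduct v b = 0) (hv' : crossProduct a v = 0) :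
    v = 0 := by
  obtain ⟨i, hi⟩ := Function.ne_iff.1 hab
  rw [cross_apply] at hv hv' hi
  have h0 := congrFun hv 0
  have h1 := congrFun hv 1
  have h2 := congrFun hv 2
  have h0' := congrFun hv' 0
  have h1' := congrFun hv' 1
  have h2' := congrFun hv' 2
  simp at h0 h1 h2 h0' h1' h2'
  funext l
  refine (mul_eq_zero.1 (?_ : v l * _ = 0)).resolve_right hi
  fin_cases i <;> fin_cases l <;> simp only [Fin.zero_eta, Fin.mk_one, Fin.reduceFinMk,
    Matrix.cons_val_zero, Matrix.cons_val_one, Matrix.cons_val]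
  · linear_combination b 0 * h0' - a 1 * h1 - a 2 * h2
  · linear_combination b 1 * h0' + a 1 * h0
  · linear_combination b 2 * h0' + a 2 * h0
  · linear_combination b 0 * h1' + a 0 * h1
  · linear_combination b 1 * h1' - a 2 * h2 - a 0 * h0
  · linear_combination b 2 * h1' + a 2 * h1
  · linear_combination b 0 * h2' + a 0 * h2
  · linear_combination b 1 * h2' + a 1 * h2
  · linear_combination b 2 * h2' - a 0 * h0 - a 1 * h1

end Parallel

/-- Two syzygies of degree `n` that are independent over the base field. -/
structure IsSyzygyPair {K : Type*} [Field K] (u : Fin 3 → TPoly K) (n : ℕ)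
    (a b : Fin 3 → TPoly K) : Prop where
  a_homogeneous : ∀ s, (a s).IsHomogeneous n
  b_homogeneous : ∀ s, (b s).IsHomogeneous n
  a_syzygy : ∑ s, a s * u s = 0
  b_syzygy : ∑ s, b s * u s = 0
  independent : ∀ x y : K, x • a + y • b = 0 → x = 0 ∧ y = 0

theorem mem_syz_iff {K : Type*} [Field K] {u a : Fin 3 → TPoly K} :
    a ∈ syz u ↔ ∑ s, a s * u s = 0 := by
  simp [syz, Fintype.linearCombination_apply]

namespace RecoversParameter

variable {K : Type*} [Field K] {u : Fin 3 → TPoly K} {F : Fin 2 → XPoly K}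
  {G : TPoly K} {k : ℕ} {a b : Fin 3 → TPoly K}

/-- Triples of forms of degree k + 2 have dimension 3k + 9, and forms of degree 3k + 6 have
dimension 3k + 7. -/
theorem exists_isSyzygyPair (h : RecoversParameter u F G (2 * (k + 2))) :
    ∃ a b, IsSyzygyPair u (k + 2) a b := by
  let Λ := combinationMap h.u_homogeneous (k + 2)
  have h1 := Λ.finrank_range_add_finrank_ker
  have h2 := (LinearMap.range Λ).finrank_le
  rw [finrank_binary_forms] at h2
  rw [finrank_triples] at h1
  have h3 : 1 < finrank K (LinearMap.ker Λ) := by omega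
  obtain ⟨x, hx⟩ := (finrank_pos_iff_exists_ne_zero (R := K) (M := LinearMap.ker Λ)).1 (by omega)
  obtain ⟨y, hxy⟩ := exists_linearIndependent_pair_of_one_lt_finrank h3 hx
  replace hxy := LinearIndependent.pair_iff.1 hxy
  refine ⟨fun s => (x.1 s).1, fun s => (y.1 s).1, fun s => (x.1 s).2, fun s => (y.1 s).2,
    congrArg Subtype.val x.2, congrArg Subtype.val y.2, fun α β hαβ => hxy α β ?_⟩
  ext1
  funext s
  exact Subtype.ext (congrFun hαβ s)

variable [Infinite K]

/-- Vanishing at (0 : 1) allows division by `X 0`, and there are no nonzero syzygies of degree k +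
1. -/
theorem syzygy_eq_zero_of_eval (h : RecoversParameter u F G (2 * (k + 2)))
    (ha : ∀ s, (a s).IsHomogeneous (k + 2)) (hau : ∑ s, a s * u s = 0)
    (h0 : ∀ s, eval ![0, 1] (a s) = 0) : a = 0 := by
  choose g c hg hc using fun s => exists_eq_X_zero_mul_add (ha s)
  have hag : ∀ s, a s = X 0 * g s := fun s => by
    have := h0 s
    rw [hc s] at this
    simp only [map_add, map_mul, map_pow, eval_X, eval_C, Matrix.cons_val_zero,
      Matrix.cons_val_one, zero_mul, zero_add, one_pow, mul_one] at this
    rw [hc s, this, C_0, zero_mul, add_zero]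
  have hg0 : g = 0 := by
    refine h.syzygy_eq_zero hg (by omega) ((mul_eq_zero.1 ?_).resolve_left (X_ne_zero (0 : Fin 2)))
    rw [← hau, Finset.mul_sum]
    exact Finset.sum_congr rfl fun s _ => by rw [hag s]; ring
  funext s
  rw [hag s, hg0]
  simp

/-- If the cross product were zero, the values of a and b at (0 : 1) would be dependent over `K`; a
nontrivial combination would then vanish at this point, hence be zero by `syzygy_eq_zero_of_eval`.
-/
theorem cross_ne_zero (h : RecoversParameter u F G (2 * (k + 2)))
    (hab : IsSyzygyPair u (k + 2) a b) : crossProduct a b ≠ 0 := by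
  intro hcross
  set α : Fin 3 → K := fun s => eval ![0, 1] (a s) with hα
  set β : Fin 3 → K := fun s => eval ![0, 1] (b s) with hβ
  have hαβ : ∀ s t, β s * α t - α s * β t = 0 := by
    have h0 := congrArg (eval ![(0 : K), 1]) (congrFun hcross 0)
    have h1 := congrArg (eval ![(0 : K), 1]) (congrFun hcross 1)
    have h2 := congrArg (eval ![(0 : K), 1]) (congrFun hcross 2)
    rw [cross_apply] at h0 h1 h2
    simp only [Matrix.cons_val_zero, Matrix.cons_val_one, Matrix.cons_val, map_sub, map_mul,
      Pi.zero_apply, map_zero] at h0 h1 h2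
    intro s t
    simp only [hα, hβ]
    fin_cases s <;> fin_cases t <;> simp only [Fin.zero_eta, Fin.mk_one, Fin.reduceFinMk] <;>
      first
        | ring1
        | linear_combination h0
        | linear_combination -h0
        | linear_combination h1
        | linear_combination -h1
        | linear_combination h2
        | linear_combination -h2
  have key : ∀ x y : K, (∀ t, x * α t + y * β t = 0) → x = 0 ∧ y = 0 := by
    intro x y hxy
    refine hab.independent x y (h.syzygy_eq_zero_of_eval (fun s => ?_) ?_ fun s => ?_)
    · exact Submodule.add_mem (homogeneousSubmodule _ K _)
        (Submodule.smul_mem _ _ (hab.a_homogeneous s))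
        (Submodule.smul_mem _ _ (hab.b_homogeneous s))
    · simp only [Pi.add_apply, Pi.smul_apply, add_mul, Finset.sum_add_distrib, smul_mul_assoc]
      rw [← Finset.smul_sum, ← Finset.smul_sum, hab.a_syzygy, hab.b_syzygy]
      simp
    · simpa [smul_eval] using hxy s
  by_cases hα0 : ∃ s, α s ≠ 0
  · obtain ⟨s, hs⟩ := hα0
    exact hs (neg_eq_zero.1 (key (β s) (-α s) fun t => by linear_combination hαβ s t).2)
  · push Not at hα0
    exact one_ne_zero (key 1 0 fun t => by simp [hα0 t]).1

/-- Two independent syzygies of degree `d / 2` are a basis of the syzygy module. -/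
theorem isMuBasis (h : RecoversParameter u F G (2 * (k + 2)))
    (hab : IsSyzygyPair u (k + 2) a b) : IsMuBasis u (2 * (k + 2)) (k + 2) a b := by
  have hcross := h.cross_ne_zero hab
  have hli : ∀ x y : TPoly K, x • a + y • b = 0 → x = 0 ∧ y = 0 := by
    intro x y hxy
    have h1 : x • crossProduct a b = 0 := by
      have := congrArg (fun v => crossProduct v b) hxy
      simpa using this
    have h2 : y • crossProduct a b = 0 := by
      have := congrArg (fun v => crossProduct a v) hxy
      simpa using this
    exact ⟨(smul_eq_zero.1 h1).resolve_right hcross, (smul_eq_zero.1 h2).resolve_right hcross⟩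
  refine ⟨le_rfl, hab.a_homogeneous, fun s => ?_, LinearIndependent.pair_iff.2 hli, ?_⟩
  · rw [show 2 * (k + 2) - (k + 2) = k + 2 by omega]
    exact hab.b_homogeneous s
  obtain ⟨c, hc⟩ := exists_eq_mul_of_parallel h.u_noCommonFactor
    (cross_parallel hab.a_syzygy hab.b_syzygy)
  obtain ⟨s₀, hs₀⟩ := Function.ne_iff.1 hcross
  have hcs := hc s₀
  -- The cross product has the same degree as u, so the factor between them is a constant γ.
  have hhom : (crossProduct a b s₀).IsHomogeneous (2 * (k + 2) + 0) := by
    have hm : ∀ s t, (a s * b t).IsHomogeneous (2 * (k + 2) + 0) := fun s t => by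
      have := (hab.a_homogeneous s).mul (hab.b_homogeneous t)
      rwa [← two_mul] at this
    rw [cross_apply]
    fin_cases s₀
    · exact (hm _ _).sub (hm _ _)
    · exact (hm _ _).sub (hm _ _)
    · exact (hm _ _).sub (hm _ _)
  obtain ⟨c₀, hc₀, hc₁⟩ := exists_form_of_dvd (h.u_homogeneous s₀) hhom (Dvd.intro_left _ hcs.symm)
  have hus : u s₀ ≠ 0 := fun h0 => hs₀ (by rw [hcs, h0, mul_zero]; rfl)
  have hcc : c = C (coeff 0 c₀) := by
    rw [← eq_C_of_isHomogeneous_zero hc₀]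
    exact mul_left_cancel₀ hus (by rw [← hc₁, hcs, mul_comm])
  set γ := coeff 0 c₀
  have hγ : γ ≠ 0 := by
    intro h0
    refine hs₀ ?_
    rw [hcs, hcc, h0, C_0, zero_mul]
    rfl
  apply le_antisymm
  · rw [Submodule.span_le]
    rintro v (rfl | rfl)
    · exact mem_syz_iff.2 hab.a_syzygy
    · exact mem_syz_iff.2 hab.b_syzygy
  · intro v hv
    rw [mem_syz_iff] at hv
    obtain ⟨x, hx⟩ := exists_eq_mul_of_parallel h.u_noCommonFactor
      (cross_parallel hv hab.b_syzygy)
    obtain ⟨y, hy⟩ := exists_eq_mul_of_parallel h.u_noCommonFactor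
      (cross_parallel hab.a_syzygy hv)
    have hx' : crossProduct v b = x • u := funext hx
    have hy' : crossProduct a v = y • u := funext hy
    have hc' : crossProduct a b = c • u := funext hc
    -- Cramer's rule: v × b = x u, a × v = y u and a × b = c u, so c v - x a - y b has zero cross
    -- product with both a and b.
    have h0 : c • v - x • a - y • b = 0 := by
      refine eq_zero_of_cross_eq_zero hcross ?_ ?_
      · simp only [map_sub, map_smul, LinearMap.sub_apply, LinearMap.smul_apply, hx', hc',
          cross_self, smul_zero, sub_zero, smul_smul]
        rw [mul_comm, sub_self]
      · simp only [map_sub, map_smul, hy', hc', cross_self, smul_zero, sub_zero, smul_smul]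
        rw [mul_comm, sub_self]
    rw [Submodule.mem_span_pair]
    refine ⟨C γ⁻¹ * x, C γ⁻¹ * y, ?_⟩
    have h1 : C γ⁻¹ * c = 1 := by rw [hcc, ← C_mul, inv_mul_cancel₀ hγ, C_1]
    rw [← one_smul (TPoly K) v, ← h1, mul_smul, mul_smul, mul_smul, ← smul_add]
    congr 1
    rw [sub_sub] at h0
    exact (sub_eq_zero.1 h0).symm

/-- Nonzero syzygies have degree at least k + 2, while 2μ ≤ 2(k + 2). -/
theorem isSyzygyPair_of_isMuBasis (h : RecoversParameter u F G (2 * (k + 2))) {μ : ℕ}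
    (hab : IsMuBasis u (2 * (k + 2)) μ a b) : μ = k + 2 ∧ IsSyzygyPair u (k + 2) a b := by
  have ha : ∑ s, a s * u s = 0 := mem_syz_iff.1 (hab.span_eq ▸ Submodule.subset_span (by simp))
  have hb : ∑ s, b s * u s = 0 := mem_syz_iff.1 (hab.span_eq ▸ Submodule.subset_span (by simp))
  have hμ : μ = k + 2 := by
    have h1 := hab.two_mul_le
    by_contra hne
    exact hab.linearIndependent.ne_zero 0
      (h.syzygy_eq_zero hab.a_homogeneous (by omega) ha)
  subst hμ
  refine ⟨rfl, hab.a_homogeneous, fun s => ?_, ha, hb, fun x y hxy => ?_⟩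
  · have := hab.b_homogeneous s
    rwa [show 2 * (k + 2) - (k + 2) = k + 2 by omega] at this
  · have h1 := LinearIndependent.pair_iff.1 hab.linearIndependent (C x) (C y) (by
      rw [← hxy]
      funext s
      simp [smul_eq_C_mul])
    exact ⟨C_eq_zero.1 h1.1, C_eq_zero.1 h1.2⟩

end RecoversParameter

/-! ### Generators of the moving curve ideal -/

namespace RecoversParameter

variable {K : Type*} [Field K] [Infinite K] {u : Fin 3 → TPoly K} {F : Fin 2 → XPoly K}
  {G : TPoly K} {k i j : ℕ} {a b : Fin 3 → TPoly K} {W : TXPoly K}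

/-- The ideal `⟨u₁, u₂, u₃⟩` contains all forms of degree at least `3 d / 2 - 1`. -/
theorem exists_combination_eq (h : RecoversParameter u F G (2 * (k + 2))) (i : ℕ) :
    ∀ g : TPoly K, g.IsHomogeneous (k + 1 + i + 2 * (k + 2)) →
      ∃ r : Fin 3 → TPoly K, (∀ s, (r s).IsHomogeneous (k + 1 + i)) ∧ g = ∑ s, r s * u s := by
  induction i with
  | zero =>
    intro g hg
    -- There are no nonzero syzygies of degree k + 1, and both sides have dimension 3k + 6;
    -- injectivity thus gives surjectivity.
    have hinj : Function.Injective (combinationMap h.u_homogeneous (k + 1)) := by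
      rw [← LinearMap.ker_eq_bot, LinearMap.ker_eq_bot']
      intro r hr
      have := h.syzygy_eq_zero (fun s => (r s).2) (by omega) (congrArg Subtype.val hr)
      exact funext fun s => Subtype.ext (congrFun this s)
    have hsurj := (LinearMap.injective_iff_surjective_of_finrank_eq_finrank
      (by rw [finrank_triples, finrank_binary_forms]; omega)).1 hinj
    obtain ⟨r, hr⟩ := hsurj ⟨g, hg⟩
    exact ⟨fun s => (r s).1, fun s => (r s).2, (congrArg Subtype.val hr).symm⟩
  | succ i ih =>
    intro g hg
    obtain ⟨p, q, hp, hq, rfl⟩ := exists_eq_mul_X_add_mul_X (n := k + 1 + i + 2 * (k + 2))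
      (by rwa [show k + 1 + i + 2 * (k + 2) + 1 = k + 1 + (i + 1) + 2 * (k + 2) by ring])
    obtain ⟨r, hr, rfl⟩ := ih p hp
    obtain ⟨r', hr', rfl⟩ := ih q hq
    refine ⟨fun s => r s * X 0 + r' s * X 1, fun s =>
      ((hr s).mul (isHomogeneous_X K 0)).add ((hr' s).mul (isHomogeneous_X K 1)), ?_⟩
    rw [Finset.sum_mul, Finset.sum_mul, ← Finset.sum_add_distrib]
    exact Finset.sum_congr rfl fun s _ => by ring

/-- Each factor `u s` split off from g is lifted to the variable `X s`, so one power of the ideal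
accounts for one X-degree. -/
theorem exists_aeval_eq_of_le (h : RecoversParameter u F G (2 * (k + 2))) (j : ℕ) :
    ∀ g : TPoly K, g.IsHomogeneous (k + 1 + i + 2 * (k + 2) * j) →
      ∃ D : TXPoly K, IsBihomogeneous D (k + 1 + i) j ∧ aeval u D = g := by
  induction j with
  | zero => exact fun g hg => ⟨C g, isBihomogeneous_C hg, by rw [aeval_C]; rfl⟩
  | succ j ih =>
    intro g hg
    obtain ⟨r, hr, rfl⟩ := h.exists_combination_eq (i + 2 * (k + 2) * j) g
      (by convert hg using 1; ring)
    choose D hD hDr using fun s => ih (r s) (by convert hr s using 1; ring)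
    refine ⟨∑ s, D s * inX (X s), IsBihomogeneous.sum _ fun s _ => ?_, ?_⟩
    · exact (hD s).mul (isBihomogeneous_inX (isHomogeneous_X K s))
    · rw [map_sum]
      exact Finset.sum_congr rfl fun s _ => by rw [map_mul, hDr, aeval_inX, aeval_X]

/-- The two moving lines of degree `k + 2` account for the forms of degree `3 k + 4` that are
missing in the ideal `⟨u₁, u₂, u₃⟩`. -/
theorem exists_combination_add_eq (h : RecoversParameter u F G (2 * (k + 2)))
    (hab : IsSyzygyPair u (k + 2) a b) {A B A' B' : TXPoly K} {p q : TPoly K}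
    (hA : IsBihomogeneous A (k + 1) 1) (hB : IsBihomogeneous B (k + 1) 1)
    (hA' : IsBihomogeneous A' (k + 1) 1) (hB' : IsBihomogeneous B' (k + 1) 1)
    (hp : p.IsHomogeneous (k + 2 * (k + 2))) (hq : q.IsHomogeneous (k + 2 * (k + 2)))
    (ha : movingLine a = A * T 0 + B * T 1) (hb : movingLine b = A' * T 0 + B' * T 1)
    (hAp : aeval u A = X 1 * p) (hBp : aeval u B = -(X 0 * p))
    (hAq : aeval u A' = X 1 * q) (hBq : aeval u B' = -(X 0 * q))
    {g : TPoly K} (hg : g.IsHomogeneous (k + 2 * (k + 2))) :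
    ∃ (r : Fin 3 → TPoly K) (x y : K), (∀ s, (r s).IsHomogeneous k) ∧
      g = ∑ s, r s * u s + C x * p + C y * q := by
  let Λ := (combinationMap h.u_homogeneous k).coprod
    ((LinearMap.toSpanSingleton K (homogeneousSubmodule (Fin 2) K _) ⟨p, hp⟩).coprod
      (LinearMap.toSpanSingleton K (homogeneousSubmodule (Fin 2) K _) ⟨q, hq⟩))
  have hΛ : ∀ r x y, (Λ (r, x, y)).1 = ∑ s, (r s).1 * u s + C x * p + C y * q := by
    intro r x y
    rw [← smul_eq_C_mul, ← smul_eq_C_mul, add_assoc]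
    rfl
  have hinj : Function.Injective Λ := by
    rw [← LinearMap.ker_eq_bot, LinearMap.ker_eq_bot']
    rintro ⟨r, x, y⟩ hr
    have hr' : ∑ s, (r s).1 * u s + C x * p + C y * q = 0 := by
      rw [← hΛ, hr]
      rfl
    have hD : IsBihomogeneous (movingLine fun s => (r s).1) k 1 :=
      isBihomogeneous_movingLine fun s => (r s).2
    have hCx : ∀ c : K, IsBihomogeneous (C (C c) : TXPoly K) 0 0 := fun c =>
      isBihomogeneous_C (isHomogeneous_C _ c)
    have haC : ∀ c : K, aeval u (C (C c) : TXPoly K) = C c := fun c => by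
      rw [aeval_C]
      rfl
    -- The relation `hr'` makes this and the next polynomial follow u in bidegree (k + 1, 1), where
    -- only zero does; together they show that the moving line of `x • a + y • b` is zero.
    have h1 : C (C x) * A + C (C y) * A' + T 1 * movingLine (fun s => (r s).1) = 0 := by
      refine h.eq_zero_of_aeval_eq_zero (i := k + 1) (j := 1) ?_ one_lt_two (by omega) ?_
      · refine (IsBihomogeneous.add ?_ ?_).add ?_
        · simpa using (hCx x).mul hA
        · simpa using (hCx y).mul hA'
        · simpa [add_comm] using (isBihomogeneous_T 1).mul hD
      · rw [map_add, map_add, map_mul, map_mul, map_mul, haC, haC, hAp, hAq, aeval_T,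
          aeval_movingLine]
        linear_combination X 1 * hr'
    have h2 : C (C x) * B + C (C y) * B' - T 0 * movingLine (fun s => (r s).1) = 0 := by
      refine h.eq_zero_of_aeval_eq_zero (i := k + 1) (j := 1) ?_ one_lt_two (by omega) ?_
      · refine (IsBihomogeneous.add ?_ ?_).sub ?_
        · simpa using (hCx x).mul hB
        · simpa using (hCx y).mul hB'
        · simpa [add_comm] using (isBihomogeneous_T 0).mul hD
      · rw [map_sub, map_add, map_mul, map_mul, map_mul, haC, haC, hBp, hBq, aeval_T,
          aeval_movingLine]
        linear_combination -X 0 * hr'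
    have h3 : movingLine (x • a + y • b) = 0 := by
      have h4 : movingLine (x • a + y • b) = C (C x) * movingLine a + C (C y) * movingLine b := by
        simp only [movingLine, Finset.mul_sum, ← Finset.sum_add_distrib]
        refine Finset.sum_congr rfl fun s _ => ?_
        rw [Pi.add_apply, Pi.smul_apply, Pi.smul_apply, smul_eq_C_mul, smul_eq_C_mul, map_add,
          map_mul, map_mul]
        ring
      rw [h4, ha, hb]
      linear_combination T 0 * h1 + T 1 * h2
    obtain ⟨rfl, rfl⟩ := hab.independent x y (movingLine_injective (h3.trans movingLine_zero.symm))
    have h5 := h.syzygy_eq_zero (fun s => (r s).2) (by omega : 2 * k + 1 < 2 * (k + 2))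
      (by simpa using hr')
    rw [(funext fun s => Subtype.ext (congrFun h5 s) : r = 0)]
    rfl
  -- Both sides have dimension 3(k + 1) + 2 = 3k + 5.
  have hsurj := (LinearMap.injective_iff_surjective_of_finrank_eq_finrank (by
    rw [finrank_prod, finrank_prod, finrank_triples, finrank_binary_forms, finrank_self]
    omega)).1 hinj
  obtain ⟨⟨r, x, y⟩, hr⟩ := hsurj ⟨g, hg⟩
  exact ⟨fun s => (r s).1, x, y, fun s => (r s).2, by rw [← hΛ, hr]⟩

/-- The case of X-degree 1 is the hypothesis; in higher X-degree g lies in ⟨u₁, u₂, u₃⟩, and the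
coefficients are treated by induction. -/
theorem exists_aeval_add_eq {p q : TPoly K} (h : RecoversParameter u F G (2 * (k + 2)))
    (hpq : ∀ g : TPoly K, g.IsHomogeneous (k + 2 * (k + 2)) →
      ∃ (r : Fin 3 → TPoly K) (x y : K), (∀ s, (r s).IsHomogeneous k) ∧
        g = ∑ s, r s * u s + C x * p + C y * q) (j : ℕ) :
    ∀ g : TPoly K, g.IsHomogeneous (k + 2 * (k + 2) * (j + 1)) →
      ∃ (D : TXPoly K) (x y : XPoly K), IsBihomogeneous D k (j + 1) ∧ x.IsHomogeneous j ∧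
        y.IsHomogeneous j ∧ g = aeval u D + aeval u x * p + aeval u y * q := by
  induction j with
  | zero =>
    intro g hg
    obtain ⟨r, x, y, hr, rfl⟩ := hpq g (by simpa using hg)
    exact ⟨movingLine r, C x, C y, isBihomogeneous_movingLine hr, isHomogeneous_C _ _,
      isHomogeneous_C _ _, by rw [aeval_movingLine, aeval_C, aeval_C]; rfl⟩
  | succ j ih =>
    intro g hg
    obtain ⟨r, hr, rfl⟩ := h.exists_combination_eq (2 * k + 3 + 2 * (k + 2) * j) g
      (by convert hg using 1; ring)
    choose D x y hD hx hy hDr using fun s => ih (r s) (by convert hr s using 1; ring)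
    refine ⟨∑ s, D s * inX (X s), ∑ s, x s * X s, ∑ s, y s * X s,
      IsBihomogeneous.sum _ fun s _ => ?_, IsHomogeneous.sum _ _ _ fun s _ => ?_,
      IsHomogeneous.sum _ _ _ fun s _ => ?_, ?_⟩
    · exact (hD s).mul (isBihomogeneous_inX (isHomogeneous_X K s))
    · exact (hx s).mul (isHomogeneous_X K s)
    · exact (hy s).mul (isHomogeneous_X K s)
    · rw [map_sum, map_sum, map_sum, Finset.sum_mul, Finset.sum_mul, ← Finset.sum_add_distrib,
        ← Finset.sum_add_distrib]
      refine Finset.sum_congr rfl fun s _ => ?_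
      rw [map_mul, map_mul, map_mul, aeval_inX, aeval_X, hDr]
      ring

/-- The generation step for moving curves of degree greater than `k + 2` in `T`. -/
theorem exists_eq_mul_T_add_of_lt (h : RecoversParameter u F G (2 * (k + 2)))
    (hW : IsBihomogeneous W (k + 3 + i) j) (hWu : aeval u W = 0) :
    ∃ A B : TXPoly K, IsBihomogeneous A (k + 2 + i) j ∧ IsBihomogeneous B (k + 2 + i) j ∧
      aeval u A = 0 ∧ aeval u B = 0 ∧ W = A * T 0 + B * T 1 := by
  obtain ⟨A, B, g, hA, hB, hg, rfl, hAg, hBg⟩ := exists_eq_mul_T_add_of_aeval_eq_zero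
    (i := k + 2 + i) (m := k + 1 + i + 2 * (k + 2) * j) h.u_homogeneous
    (by convert hW using 1; ring) hWu (by ring)
  -- The pair (A, B) may be changed by (-T₂ D, T₁ D); with g = D(T, u) this makes both members
  -- follow u.
  obtain ⟨D, hD, rfl⟩ := h.exists_aeval_eq_of_le j g hg
  have hT : ∀ s, IsBihomogeneous (T s * D) (k + 2 + i) j := fun s => by
    have := (isBihomogeneous_T s).mul hD
    rwa [zero_add, show 1 + (k + 1 + i) = k + 2 + i by ring] at this
  refine ⟨A - T 1 * D, B + T 0 * D, hA.sub (hT 1), hB.add (hT 0), ?_, ?_, by ring⟩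
  · rw [map_sub, map_mul, aeval_T, hAg, sub_self]
  · rw [map_add, map_mul, aeval_T, hBg, neg_add_cancel]

/-- The generation step for moving curves of degree `k + 2` in `T`. -/
theorem exists_eq_mul_T_add_of_eq (h : RecoversParameter u F G (2 * (k + 2)))
    (hab : IsSyzygyPair u (k + 2) a b) (hW : IsBihomogeneous W (k + 2) (j + 1))
    (hWu : aeval u W = 0) :
    ∃ (A B : TXPoly K) (x y : XPoly K), IsBihomogeneous A (k + 1) (j + 1) ∧
      IsBihomogeneous B (k + 1) (j + 1) ∧ aeval u A = 0 ∧ aeval u B = 0 ∧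
      W = A * T 0 + B * T 1 + inX x * movingLine a + inX y * movingLine b := by
  obtain ⟨Aa, Ba, p, hAa, hBa, hp, ha, hAp, hBp⟩ := exists_eq_mul_T_add_of_aeval_eq_zero
    (i := k + 1) (m := k + 2 * (k + 2)) h.u_homogeneous
    (isBihomogeneous_movingLine hab.a_homogeneous)
    (by rw [aeval_movingLine, hab.a_syzygy]) (by ring)
  obtain ⟨Ab, Bb, q, hAb, hBb, hq, hb, hAq, hBq⟩ := exists_eq_mul_T_add_of_aeval_eq_zero
    (i := k + 1) (m := k + 2 * (k + 2)) h.u_homogeneous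
    (isBihomogeneous_movingLine hab.b_homogeneous)
    (by rw [aeval_movingLine, hab.b_syzygy]) (by ring)
  obtain ⟨A, B, g, hA, hB, hg, rfl, hAg, hBg⟩ := exists_eq_mul_T_add_of_aeval_eq_zero
    (i := k + 1) (m := k + 2 * (k + 2) * (j + 1)) h.u_homogeneous hW hWu (by ring)
  -- Here g need not be a value D(T, u): the remaining part is a combination of the obstructions p
  -- and q of the two moving lines and is absorbed by subtracting multiples of these lines.
  obtain ⟨D, x, y, hD, hx, hy, rfl⟩ := h.exists_aeval_add_eq
    (fun g hg => h.exists_combination_add_eq hab hAa hBa hAb hBb hp hq ha hb hAp hBp hAq hBq hg)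
    j g hg
  have hT : ∀ s, IsBihomogeneous (T s * D) (k + 1) (j + 1) := fun s => by
    have := (isBihomogeneous_T s).mul hD
    rwa [zero_add, add_comm 1 k] at this
  have hmul : ∀ {z : XPoly K} {V : TXPoly K}, z.IsHomogeneous j → IsBihomogeneous V (k + 1) 1 →
      IsBihomogeneous (inX z * V) (k + 1) (j + 1) := fun hz hV => by
    have := (isBihomogeneous_inX hz).mul hV
    rwa [zero_add] at this
  refine ⟨A - T 1 * D - inX x * Aa - inX y * Ab, B + T 0 * D - inX x * Ba - inX y * Bb, x, y,
    ((hA.sub (hT 1)).sub (hmul hx hAa)).sub (hmul hy hAb),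
    ((hB.add (hT 0)).sub (hmul hx hBa)).sub (hmul hy hBb), ?_, ?_, ?_⟩
  · simp only [map_sub, map_mul, aeval_T, aeval_inX, hAg, hAp, hAq]
    ring
  · simp only [map_sub, map_add, map_mul, aeval_T, aeval_inX, hBg, hBp, hBq]
    ring
  · rw [ha, hb]
    ring

/-- An ideal that contains the pencil, two independent moving lines of degree `k + 2`, and moving
curves of all bidegrees `(i, 2 (k + 2) - 2 i)`, `i < k + 2`, that are not multiples of the pencil,
contains the moving curve ideal. -/
theorem movingCurveIdeal_le (h : RecoversParameter u F G (2 * (k + 2)))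
    (hab : IsSyzygyPair u (k + 2) a b) {E : XPoly K} (hE : Irreducible E)
    (hEh : E.IsHomogeneous (2 * (k + 2))) (hEu : aeval u E = 0) {P : ℕ → TXPoly K} {c : K}
    (hc : c ≠ 0) (hPb : ∀ i < k + 2, IsBihomogeneous (P i) i (2 * (k + 2) - 2 * i))
    (hP : ∀ i < k + 2, substT F (P i) = C c * E) {I : Ideal (TXPoly K)} (hpen : pencil F ∈ I)
    (haI : movingLine a ∈ I) (hbI : movingLine b ∈ I) (hPI : ∀ i < k + 2, P i ∈ I) :
    movingCurveIdeal u ≤ I := by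
  have low : ∀ i < k + 2, ∀ (j : ℕ) (W : TXPoly K), IsBihomogeneous W i j → aeval u W = 0 →
      W ∈ I := by
    intro i hi j W hW hWu
    by_cases hW0 : substT F W = 0
    · exact I.mem_of_dvd (h.pencil_dvd hW hW0) hpen
    · have hWh := hW.substT h.F_homogeneous
      have hWu' := (h.aeval_substT_eq_zero_iff hW).2 hWu
      have hle := h.degree_le hWh hW0 hWu'
      obtain ⟨n, hn⟩ := Nat.exists_eq_add_of_le hle
      rw [hn] at hWh
      obtain ⟨z, hz, hWz⟩ := exists_form_of_dvd hEh hWh (h.dvd_of_aeval_eq_zero hE hEh hEu hWh hWu')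
      -- W(F, X) = z E and P_i(F, X) = c E, so the difference vanishes under T ↦ F(X).
      have h1 : IsBihomogeneous (W - inX (C c⁻¹ * z) * P i) i j := by
        refine hW.sub ?_
        have h2 := (isBihomogeneous_inX (hz.C_mul c⁻¹)).mul (hPb i hi)
        rwa [zero_add, show n + (2 * (k + 2) - 2 * i) = j by omega] at h2
      have h3 : substT F (W - inX (C c⁻¹ * z) * P i) = 0 := by
        rw [map_sub, map_mul, substT_inX, hP i hi, hWz]
        have h4 : (C c⁻¹ * C c : XPoly K) = 1 := by rw [← C_mul, inv_mul_cancel₀ hc, C_1]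
        linear_combination (-E * z) * h4
      rw [← sub_add_cancel W (inX (C c⁻¹ * z) * P i)]
      exact I.add_mem (I.mem_of_dvd (h.pencil_dvd h1 h3) hpen) (I.mul_mem_left _ (hPI i hi))
  have mid : ∀ (j : ℕ) (W : TXPoly K), IsBihomogeneous W (k + 2) j → aeval u W = 0 → W ∈ I := by
    intro j W hW hWu
    -- In X-degree 0 the substitution X ↦ u changes nothing, so W itself is zero.
    obtain _ | j := j
    · rw [eq_C_of_isHomogeneous_zero hW.1, aeval_C] at hWu
      rw [eq_C_of_isHomogeneous_zero hW.1, show coeff 0 W = 0 from hWu, C_0]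
      exact I.zero_mem
    · obtain ⟨A, B, x, y, hA, hB, hAu, hBu, rfl⟩ := h.exists_eq_mul_T_add_of_eq hab hW hWu
      exact I.add_mem (I.add_mem (I.add_mem
        (I.mul_mem_right _ (low (k + 1) (by omega) _ A hA hAu))
        (I.mul_mem_right _ (low (k + 1) (by omega) _ B hB hBu)))
        (I.mul_mem_left _ haI)) (I.mul_mem_left _ hbI)
  have high : ∀ (i j : ℕ) (W : TXPoly K), IsBihomogeneous W (k + 2 + i) j → aeval u W = 0 →
      W ∈ I := by
    intro i
    induction i with
    | zero => exact mid
    | succ i ih =>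
      intro j W hW hWu
      obtain ⟨A, B, hA, hB, hAu, hBu, rfl⟩ := h.exists_eq_mul_T_add_of_lt (i := i)
        (by convert hW using 1; ring) hWu
      exact I.add_mem (I.mul_mem_right _ (ih j A hA hAu)) (I.mul_mem_right _ (ih j B hB hBu))
  intro W hW
  refine mem_of_bihomogeneousComponent_mem fun i j => ?_
  have h1 := isBihomogeneous_bihomogeneousComponent i j W
  have h2 := h1.mem_movingCurveIdeal_iff.1
    (bihomogeneousComponent_mem_movingCurveIdeal h.u_homogeneous hW i j)
  by_cases hi : i < k + 2
  · exact low i hi j _ h1 h2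
  · obtain ⟨n, rfl⟩ := Nat.exists_eq_add_of_le (not_lt.1 hi)
    exact high n j _ h1 h2

end RecoversParameter

/-! ### Minimality -/

/-- A proper subset of the range omits some `y s`, hence lies in the image of the other indices. The
same condition on the family also excludes repetitions, which gives the number of generators. -/
theorem isMinimalGeneratingSet_range {A ι : Type*} [CommRing A] {y : ι → A} {I : Ideal A}
    (hy : ∀ s, y s ∉ Ideal.span (y '' {t | t ≠ s})) (hI : Ideal.span (Set.range y) = I) :
    IsMinimalGeneratingSet (Set.range y) I := by
  refine ⟨hI, fun J hJ hJI => ?_⟩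
  obtain ⟨_, ⟨s, rfl⟩, hs⟩ := Set.exists_of_ssubset hJ
  refine hy s (Ideal.span_mono ?_ (hJI ▸ hI ▸ Ideal.subset_span (Set.mem_range_self s) :
    y s ∈ Ideal.span J))
  intro x hx
  obtain ⟨t, rfl⟩ := hJ.1 hx
  refine ⟨t, ?_, rfl⟩
  rintro rfl
  exact hs hx

theorem injective_of_notMem_span {A ι : Type*} [CommRing A] {y : ι → A}
    (hy : ∀ s, y s ∉ Ideal.span (y '' {t | t ≠ s})) : Function.Injective y := by
  intro s t hst
  by_contra hne
  exact hy s (hst ▸ Ideal.subset_span ⟨t, fun h => hne h.symm, rfl⟩)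

section

variable {K : Type*} [Field K] {u : Fin 3 → TPoly K} {F : Fin 2 → XPoly K}
  {G : TPoly K} {k i j : ℕ} {a b : Fin 3 → TPoly K} {V W : TXPoly K}

theorem exists_eq_C_mul_of_mem_span (hV : IsBihomogeneous V i j) (hW : IsBihomogeneous W i j)
    (h : W ∈ Ideal.span {V}) : ∃ c : K, W = C (C c) * V := by
  obtain ⟨D, rfl⟩ := Ideal.mem_span_singleton.1 h
  have h1 := bihomogeneousComponent_mul hV 0 0 D
  rw [add_zero, add_zero, hW.component_eq] at h1
  have h2 := isBihomogeneous_bihomogeneousComponent 0 0 D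
  rw [eq_C_of_isHomogeneous_zero h2.1, eq_C_of_isHomogeneous_zero (h2.2 0), mul_comm V (C _)] at h1
  exact ⟨_, h1⟩

theorem movingLine_smul (c : K) (a : Fin 3 → TPoly K) :
    movingLine (c • a) = C (C c) * movingLine a := by
  simp only [movingLine, Finset.mul_sum]
  refine Finset.sum_congr rfl fun s _ => ?_
  rw [Pi.smul_apply, smul_eq_C_mul, map_mul, mul_assoc]

theorem pencil_ne_zero (hF : F 0 ≠ 0) : pencil F ≠ 0 := by
  intro h
  -- The substitution T ↦ (0, -1) turns the pencil into `F 0`.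
  have h1 := congrArg (substT ![0, -1]) h
  rw [pencil, map_sub, map_mul, map_mul, substT_T, substT_T, substT_inX, substT_inX,
    map_zero] at h1
  simp at h1
  exact hF h1

/-- The pencil, two moving lines and a chain of moving curves. -/
def generators (F : Fin 2 → XPoly K) (a b : Fin 3 → TPoly K) (P : ℕ → TXPoly K) (n : ℕ) :
    Fin 3 ⊕ Fin n → TXPoly K :=
  Sum.elim ![pencil F, movingLine a, movingLine b] fun i => P i

theorem range_generators (P : ℕ → TXPoly K) (n : ℕ) :
    Set.range (generators F a b P n) =
      {pencil F, movingLine a, movingLine b} ∪ P '' {j | j < n} := by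
  rw [generators, Set.Sum.elim_range]
  congr 1
  · ext x
    simp only [Matrix.range_cons, Matrix.range_empty, Set.union_empty, Set.mem_union,
      Set.mem_singleton_iff, Set.mem_insert_iff]
  · ext x
    constructor
    · rintro ⟨i, rfl⟩
      exact ⟨i, i.2, rfl⟩
    · rintro ⟨i, hi, rfl⟩
      exact ⟨⟨i, hi⟩, rfl⟩

theorem generators_notMem_span (hF : ∀ s, (F s).IsHomogeneous 2) (hF0 : F 0 ≠ 0)
    (hab : IsSyzygyPair u (k + 2) a b) {P : ℕ → TXPoly K}
    (hPb : ∀ i < k + 2, IsBihomogeneous (P i) i (2 * (k + 2) - 2 * i))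
    (hP : ∀ i < k + 2, substT F (P i) ≠ 0) (s : Fin 3 ⊕ Fin (k + 2)) :
    generators F a b P (k + 2) s ∉
      Ideal.span (generators F a b P (k + 2) '' {t | t ≠ s}) := by
  set y := generators F a b P (k + 2) with hy
  let α : Fin 3 ⊕ Fin (k + 2) → ℕ := Sum.elim ![1, k + 2, k + 2] fun i => i
  let β : Fin 3 ⊕ Fin (k + 2) → ℕ := Sum.elim ![2, 1, 1] fun i => 2 * (k + 2) - 2 * i
  have hpen := isBihomogeneous_pencil hF
  have ha := isBihomogeneous_movingLine hab.a_homogeneous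
  have hb := isBihomogeneous_movingLine hab.b_homogeneous
  have hyb : ∀ s, IsBihomogeneous (y s) (α s) (β s) := by
    rintro (s | s)
    · fin_cases s
      · exact hpen
      · exact ha
      · exact hb
    · exact hPb s s.2
  -- By bidegrees, at most one other generator `y t` can contribute to `y s`.
  have hl : ∀ {s t}, (∀ r, r ≠ s → α r ≤ α s → β r ≤ β s → r = t) →
      y s ∈ Ideal.span (y '' {t | t ≠ s}) → y s ∈ Ideal.span {y t} := by
    intro s t hst hs
    refine Ideal.span_mono ?_ (mem_span_of_isBihomogeneous hyb (hyb s) hs)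
    rintro _ ⟨r, ⟨h1, h2, h3⟩, rfl⟩
    rw [hst r h1 h2 h3]
    rfl
  intro hs
  obtain s | s := s
  · fin_cases s
    · have h1 : pencil F ∈ Ideal.span {P (k + 1)} := by
        refine hl (t := Sum.inr ⟨k + 1, by omega⟩) ?_ hs
        rintro (r | r) h1 h2 h3
        · fin_cases r
          · exact absurd rfl h1
          · exact absurd h2 (by simp [α])
          · exact absurd h2 (by simp [α])
        · have h4 : 2 * (k + 2) - 2 * r.1 ≤ 2 := h3
          have := r.2
          exact congrArg Sum.inr (Fin.ext (by simp only; omega))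
      have hk : IsBihomogeneous (P (k + 1)) (k + 1) 2 := by
        have := hPb (k + 1) (by omega)
        rwa [show 2 * (k + 2) - 2 * (k + 1) = 2 by omega] at this
      -- `P (k + 1)` has T-degree k + 1, so it can divide the nonzero pencil only for k = 0. Then
      -- the bidegrees agree and the quotient is a constant, which must be zero since T ↦ F(X) kills
      -- the pencil but not `P 1`.
      obtain rfl | hk0 := Nat.eq_zero_or_pos k
      · obtain ⟨c, hc⟩ := exists_eq_C_mul_of_mem_span hk hpen h1
        have h2 := congrArg (substT F) hc
        rw [substT_pencil, map_mul, substT_C, aeval_C, eq_comm, mul_eq_zero,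
          or_iff_left (hP _ (by omega))] at h2
        rw [(map_eq_zero (algebraMap K (XPoly K))).1 h2, C_0, C_0, zero_mul] at hc
        exact pencil_ne_zero hF0 hc
      · obtain ⟨D, hD⟩ := Ideal.mem_span_singleton.1 h1
        have h2 := bihomogeneousComponent_mul_eq_zero (i' := 1) (j' := 2) hk (by omega) D
        rw [← hD, hpen.component_eq] at h2
        exact pencil_ne_zero hF0 h2
    · have h1 : movingLine a ∈ Ideal.span {movingLine b} := by
        refine hl (t := Sum.inl 2) ?_ hs
        rintro (r | r) h1 h2 h3
        · fin_cases r
          · exact absurd h3 (by simp [β])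
          · exact absurd rfl h1
          · rfl
        · have h4 : 2 * (k + 2) - 2 * r.1 ≤ 1 := h3
          have := r.2
          omega
      obtain ⟨c, hc⟩ := exists_eq_C_mul_of_mem_span hb ha h1
      rw [← movingLine_smul] at hc
      have h2 := movingLine_injective hc
      exact one_ne_zero (hab.independent 1 (-c) (by rw [h2]; module)).1
    · have h1 : movingLine b ∈ Ideal.span {movingLine a} := by
        refine hl (t := Sum.inl 1) ?_ hs
        rintro (r | r) h1 h2 h3
        · fin_cases r
          · exact absurd h3 (by simp [β])
          · rfl
          · exact absurd rfl h1
        · have h4 : 2 * (k + 2) - 2 * r.1 ≤ 1 := h3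
          have := r.2
          omega
      obtain ⟨c, hc⟩ := exists_eq_C_mul_of_mem_span ha hb h1
      rw [← movingLine_smul] at hc
      have h2 := movingLine_injective hc
      exact one_ne_zero (hab.independent (-c) 1 (by rw [h2]; module)).2
  · have h1 : P s ∈ Ideal.span {pencil F} := by
      refine hl (t := Sum.inl 0) ?_ hs
      have hs2 := s.2
      rintro (r | r) h1 h2 h3
      · fin_cases r
        · rfl
        · have h4 : k + 2 ≤ s.1 := h2
          omega
        · have h4 : k + 2 ≤ s.1 := h2
          omega
      · have h4 : r.1 ≤ s.1 := h2
        have h5 : 2 * (k + 2) - 2 * r.1 ≤ 2 * (k + 2) - 2 * s.1 := h3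
        exact absurd (congrArg Sum.inr (Fin.ext (by omega))) h1
    obtain ⟨D, hD⟩ := Ideal.mem_span_singleton.1 h1
    exact hP s s.2 (by rw [hD, map_mul, substT_pencil, zero_mul])

/-! ### Chains -/

/-- Any element of positive T-degree can be split, and each step trades one T-degree for two
X-degrees. The values of P above m play no role, so a shorter chain is extended by overwriting its
value at m + 1. -/
theorem exists_chain (hF : ∀ s, (F s).IsHomogeneous 2) (n m : ℕ) :
    ∀ V : TXPoly K, m < n → IsBihomogeneous V m (2 * n - 2 * m) →
      ∃ P : ℕ → TXPoly K, P m = V ∧ ∀ j < m, ∃ A B : TXPoly K,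
        IsBihomogeneous A j (2 * n - 2 * (j + 1)) ∧ IsBihomogeneous B j (2 * n - 2 * (j + 1)) ∧
        P (j + 1) = A * T 0 + B * T 1 ∧ P j = A * inX (F 0) + B * inX (F 1) := by
  induction m with
  | zero => exact fun V _ _ => ⟨fun _ => V, rfl, fun j hj => absurd hj (Nat.not_lt_zero j)⟩
  | succ m ih =>
    intro V hm hV
    obtain ⟨A, B, hA, hB, rfl⟩ := hV.exists_eq_mul_T_add
    obtain ⟨P, hPm, hP⟩ := ih (A * inX (F 0) + B * inX (F 1)) (by omega) (by
      have h1 := (hA.mul (isBihomogeneous_inX (hF 0))).add (hB.mul (isBihomogeneous_inX (hF 1)))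
      rwa [add_zero, show 2 * n - 2 * (m + 1) + 2 = 2 * n - 2 * m by omega] at h1)
    refine ⟨Function.update P (m + 1) (A * T 0 + B * T 1), by simp, fun j hj => ?_⟩
    obtain rfl | hjm := Nat.eq_or_lt_of_le (Nat.le_of_lt_succ hj)
    · exact ⟨A, B, hA, hB, by simp, by simp [hPm]⟩
    · rw [Function.update_of_ne (by omega), Function.update_of_ne (by omega)]
      exact hP j hjm

theorem exists_isChainFrom (hF : ∀ s, (F s).IsHomogeneous 2) {Q : TXPoly K}
    (hQ : IsBihomogeneous Q (k + 1) 2) : ∃ P, IsChainFrom F (k + 2) Q P := by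
  obtain ⟨P, h1, h2⟩ := exists_chain hF (k + 2) (k + 1) Q (by omega)
    (by rwa [show 2 * (k + 2) - 2 * (k + 1) = 2 by omega])
  exact ⟨P, h1, fun j hj => h2 j (by omega)⟩

/-- A T₁ + B T₂ and A F₁ + B F₂ have the same image under T ↦ F(X), whichever A and B are chosen;
this is why the choices in a chain do not matter. -/
theorem IsChainFrom.isBihomogeneous_and_substT_eq (hF : ∀ s, (F s).IsHomogeneous 2) {Q : TXPoly K}
    (hQ : IsBihomogeneous Q (k + 1) 2) {P : ℕ → TXPoly K} (hP : IsChainFrom F (k + 2) Q P) :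
    ∀ i < k + 2, IsBihomogeneous (P i) i (2 * (k + 2) - 2 * i) ∧
      substT F (P i) = substT F Q := by
  have key : ∀ n i, n + i = k + 1 → IsBihomogeneous (P i) i (2 * (k + 2) - 2 * i) ∧
      substT F (P i) = substT F Q := by
    intro n
    induction n with
    | zero =>
      intro i hi
      obtain rfl : i = k + 1 := by omega
      have h1 : P (k + 1) = Q := hP.1
      rw [h1, show 2 * (k + 2) - 2 * (k + 1) = 2 by omega]
      exact ⟨hQ, rfl⟩
    | succ n ih =>
      intro i hi
      obtain ⟨A, B, hA, hB, h1, h2⟩ := hP.2 i (by omega)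
      refine ⟨?_, ?_⟩
      · rw [h2]
        have h3 := (hA.mul (isBihomogeneous_inX (hF 0))).add (hB.mul (isBihomogeneous_inX (hF 1)))
        rwa [add_zero, show 2 * (k + 2) - 2 * (i + 1) + 2 = 2 * (k + 2) - 2 * i by omega] at h3
      · rw [← (ih (i + 1) (by omega)).2, h1, h2]
        simp only [map_add, map_mul, substT_T, substT_inX]
  exact fun i hi => key (k + 1 - i) i (by omega)

theorem eq_inX_substT (hW : IsBihomogeneous W 0 j) (F : Fin 2 → XPoly K) :
    W = inX (substT F W) := by
  obtain ⟨w, rfl⟩ := eq_inX_of_coeff_isHomogeneous_zero hW.2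
  rw [substT_inX]

namespace RecoversParameter

variable {E : XPoly K} {e : ℕ} {Q : TXPoly K}

theorem substT_ne_zero (h : RecoversParameter u F G (2 * (k + 2)))
    (hQ : IsExtraConic u F (k + 2) Q) : substT F Q ≠ 0 := fun h0 =>
  hQ.2.2 (Ideal.mem_span_singleton.2 (h.pencil_dvd hQ.2.1 h0))

theorem aeval_substT_eq_zero (h : RecoversParameter u F G (2 * (k + 2)))
    (hQ : IsExtraConic u F (k + 2) Q) : aeval u (substT F Q) = 0 :=
  (h.aeval_substT_eq_zero_iff hQ.2.1).2 (hQ.2.1.mem_movingCurveIdeal_iff.1 hQ.1)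

theorem isHomogeneous_substT (h : RecoversParameter u F G (2 * (k + 2)))
    (hQ : IsExtraConic u F (k + 2) Q) : (substT F Q).IsHomogeneous (2 * (k + 2)) :=
  IsBihomogeneous.substT (i := k + 1) h.F_homogeneous hQ.2.1

variable [Infinite K]

/-- The degree of the curve is the degree of the parameterization. -/
theorem degree_eq (h : RecoversParameter u F G (2 * (k + 2))) (hE : Irreducible E)
    (hEh : E.IsHomogeneous e) (hEu : aeval u E = 0) : e = 2 * (k + 2) := by
  -- Q(F, X) is a nonzero form of degree 2(k + 2) divisible by E, which bounds the degree of E from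
  -- above.
  obtain ⟨Q, hQ⟩ := exists_isExtraConic (F := F) h.u_homogeneous h.F_homogeneous
  refine le_antisymm ?_ (h.degree_le hEh hE.ne_zero hEu)
  by_contra! hlt
  have hQh := h.isHomogeneous_substT hQ
  exact h.substT_ne_zero hQ (eq_zero_of_dvd_of_degree_lt hEh hQh
    (h.dvd_of_aeval_eq_zero hE hEh hEu hQh (h.aeval_substT_eq_zero hQ)) hlt)

/-- E divides Q(F, X), and both have degree 2(k + 2); the quotient is a constant. -/
theorem exists_substT_eq (h : RecoversParameter u F G (2 * (k + 2))) (hE : Irreducible E)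
    (hEh : E.IsHomogeneous (2 * (k + 2))) (hEu : aeval u E = 0)
    (hQ : IsExtraConic u F (k + 2) Q) : ∃ c : K, c ≠ 0 ∧ substT F Q = C c * E := by
  have hQh := h.isHomogeneous_substT hQ
  obtain ⟨g, hg, hgQ⟩ := exists_form_of_dvd (n := 0) hEh hQh
    (h.dvd_of_aeval_eq_zero hE hEh hEu hQh (h.aeval_substT_eq_zero hQ))
  rw [eq_C_of_isHomogeneous_zero hg, mul_comm] at hgQ
  refine ⟨_, fun h0 => h.substT_ne_zero hQ ?_, hgQ⟩
  rw [hgQ, h0, C_0, zero_mul]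

theorem exists_chain_eq (h : RecoversParameter u F G (2 * (k + 2))) (hE : Irreducible E)
    (hEh : E.IsHomogeneous (2 * (k + 2))) (hEu : aeval u E = 0) :
    ∃ Q P, IsExtraConic u F (k + 2) Q ∧ IsChainFrom F (k + 2) Q P ∧ P 0 = inX E := by
  obtain ⟨Q, hQ⟩ := exists_isExtraConic (F := F) h.u_homogeneous h.F_homogeneous
  obtain ⟨c, hc, hQc⟩ := h.exists_substT_eq hE hEh hEu hQ
  have hb : IsBihomogeneous Q (k + 1) 2 := hQ.2.1
  -- Rescaling Q by the inverse of c makes the chain end exactly at E.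
  have hb' : IsBihomogeneous (C (C c⁻¹) * Q) (k + 1) 2 := by
    simpa using (isBihomogeneous_C (isHomogeneous_C (Fin 2) c⁻¹)).mul hb
  have hcQ : C (C c) * (C (C c⁻¹) * Q) = Q := by
    rw [← mul_assoc, ← C_mul, ← C_mul, mul_inv_cancel₀ hc, C_1, C_1, one_mul]
  have hQ' : IsExtraConic u F (k + 2) (C (C c⁻¹) * Q) :=
    ⟨Ideal.mul_mem_left _ _ hQ.1, hb', fun hmem =>
      hQ.2.2 (hcQ ▸ Ideal.mul_mem_left _ (C (C c)) hmem)⟩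
  obtain ⟨P, hP⟩ := exists_isChainFrom h.F_homogeneous hb'
  obtain ⟨h1, h2⟩ := hP.isBihomogeneous_and_substT_eq h.F_homogeneous hb' 0 (by omega)
  refine ⟨_, P, hQ', hP, ?_⟩
  rw [eq_inX_substT h1 F, h2, map_mul, hQc, substT_C, aeval_C]
  change inX (C c⁻¹ * (C c * E)) = inX E
  rw [← mul_assoc, ← C_mul, inv_mul_cancel₀ hc, C_1, one_mul]

end RecoversParameter

end

/-! ### Reduction of the geometric hypotheses and the main theorem -/

/-- The algebraic content of a parameterization by conics that is not one by lines. -/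
theorem IsParameterizedBy.recoversParameter {K : Type*} [Field K] [Infinite K] {k : ℕ}
    {E : XPoly K} {F : Fin 2 → XPoly K} {u : Fin 3 → TPoly K}
    (hconics : IsParameterizedBy E 2 F (2 * k) u)
    (hlines : ¬ ∃ L : Fin 2 → XPoly K, IsParameterizedBy E 1 L (2 * k) u) :
    ∃ (n : ℕ) (G : TPoly K), k = n + 2 ∧ RecoversParameter u F G (2 * k) := by
  obtain ⟨G, hG0, hG⟩ := hconics.exists_aeval_eq
  have hrec : 0 < 2 * k → RecoversParameter u F G (2 * k) := fun hk =>
    ⟨hk, hconics.u_homogeneous, hconics.u_noCommonFactor, hconics.F_homogeneous,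
      hconics.F_noCommonFactor, hG0, hG⟩
  match k with
  | 0 =>
    exfalso
    -- For k = 0 the form F₁(u) would be a constant divisible by T₁, hence zero, although it is T₁ G
    -- with G nonzero.
    have h1 := IsHomogeneous.aeval (hconics.F_homogeneous 0) u hconics.u_homogeneous
    have h2 := eq_zero_of_dvd_of_degree_lt (isHomogeneous_X K (0 : Fin 2)) h1
      (hG 0 ▸ Dvd.intro _ rfl) (by norm_num)
    rw [hG] at h2
    exact mul_ne_zero (X_ne_zero _) hG0 h2
  | 1 =>
    obtain ⟨L, g, hL, hLc, hg, hLg⟩ := (hrec (by norm_num)).exists_lines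
    exact absurd ⟨L, hconics.of_aeval_eq hL hLc hg hLg⟩ hlines
  | n + 2 => exact ⟨n, G, rfl, hrec (by omega)⟩

end ConicCurve

end

theorem theorem5p5 {K : Type*} [Field K] [IsAlgClosed K] (k e : ℕ)
    (E : ConicCurve.XPoly K) (hE : Irreducible E) (hEh : E.IsHomogeneous e)
    (F : Fin 2 → ConicCurve.XPoly K) (u : Fin 3 → ConicCurve.TPoly K)
    (hconics : ConicCurve.IsParameterizedBy E 2 F (2 * k) u)
    (hlines : ¬ ∃ L : Fin 2 → ConicCurve.XPoly K,
      ConicCurve.IsParameterizedBy E 1 L (2 * k) u) :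
    (∃ a b : Fin 3 → ConicCurve.TPoly K, ConicCurve.IsMuBasis u (2 * k) k a b) ∧
    (∃ (Q : ConicCurve.TXPoly K) (P : ℕ → ConicCurve.TXPoly K),
      ConicCurve.IsExtraConic u F k Q ∧ ConicCurve.IsChainFrom F k Q P ∧
      P 0 = ConicCurve.inX E) ∧
    (∀ Q : ConicCurve.TXPoly K, ConicCurve.IsExtraConic u F k Q →
      ∃ P : ℕ → ConicCurve.TXPoly K, ConicCurve.IsChainFrom F k Q P) ∧
    (∀ (μ : ℕ) (a b : Fin 3 → ConicCurve.TPoly K) (Q : ConicCurve.TXPoly K)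
      (P : ℕ → ConicCurve.TXPoly K),
      ConicCurve.IsMuBasis u (2 * k) μ a b → ConicCurve.IsExtraConic u F k Q →
      ConicCurve.IsChainFrom F k Q P →
      μ = k ∧
      (∀ j < k, ConicCurve.IsBihomogeneous (P j) j (2 * k - 2 * j)) ∧
      (∃ c : K, c ≠ 0 ∧ P 0 = ConicCurve.inX (MvPolynomial.C c * E)) ∧
      ConicCurve.IsMinimalGeneratingSet
        ({ConicCurve.pencil F, ConicCurve.movingLine a, ConicCurve.movingLine b} ∪
          P '' {j | j < k})
        (ConicCurve.movingCurveIdeal u) ∧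
      ({ConicCurve.pencil F, ConicCurve.movingLine a, ConicCurve.movingLine b} ∪
          P '' {j | j < k} : Set (ConicCurve.TXPoly K)).ncard = k + 3) := by
  open ConicCurve in
  have : Infinite K := IsAlgClosed.instInfinite
  obtain ⟨n, G, rfl, h⟩ := hconics.recoversParameter hlines
  have hEu := hconics.aeval_eq_zero hEh
  obtain rfl := h.degree_eq hE hEh hEu
  have hF0 := ne_zero_of_noCommonFactor h.F_noCommonFactor h.F_homogeneous
  refine ⟨?_, h.exists_chain_eq hE hEh hEu,
    fun Q hQ => exists_isChainFrom h.F_homogeneous hQ.2.1, ?_⟩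
  · obtain ⟨a, b, hab⟩ := h.exists_isSyzygyPair
    exact ⟨a, b, h.isMuBasis hab⟩
  intro μ a b Q P hμ hQ hP
  obtain ⟨rfl, hab⟩ := h.isSyzygyPair_of_isMuBasis hμ
  obtain ⟨c, hc, hQc⟩ := h.exists_substT_eq hE hEh hEu hQ
  have hb : IsBihomogeneous Q (n + 1) 2 := hQ.2.1
  have hPQ := hP.isBihomogeneous_and_substT_eq h.F_homogeneous hb
  have hPb := fun i hi => (hPQ i hi).1
  have hPs : ∀ i < n + 2, substT F (P i) = MvPolynomial.C c * E := fun i hi =>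
    (hPQ i hi).2.trans hQc
  have hnot := generators_notMem_span h.F_homogeneous hF0 hab hPb
    fun i hi => (hPQ i hi).2 ▸ h.substT_ne_zero hQ
  refine ⟨rfl, hPb, ⟨c, hc, ?_⟩, ?_, ?_⟩
  · rw [eq_inX_substT (hPb 0 (by omega)) F, hPs 0 (by omega)]
  · rw [← range_generators]
    refine isMinimalGeneratingSet_range hnot (le_antisymm ?_ ?_)
    · rw [Ideal.span_le]
      rintro _ ⟨s | s, rfl⟩
      · fin_cases s
        · exact (isBihomogeneous_pencil h.F_homogeneous).mem_movingCurveIdeal_iff.2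
            (aeval_pencil h.aeval_eq)
        · exact (isBihomogeneous_movingLine hab.a_homogeneous).mem_movingCurveIdeal_iff.2
            (by rw [aeval_movingLine, hab.a_syzygy])
        · exact (isBihomogeneous_movingLine hab.b_homogeneous).mem_movingCurveIdeal_iff.2
            (by rw [aeval_movingLine, hab.b_syzygy])
      · refine (hPb s s.2).mem_movingCurveIdeal_iff.2
          ((h.aeval_substT_eq_zero_iff (hPb s s.2)).1 ?_)
        rw [hPs s s.2, map_mul, hEu, mul_zero]
    · exact h.movingCurveIdeal_le hab hE hEh hEu hc hPb hPs
        (Ideal.subset_span ⟨Sum.inl 0, rfl⟩) (Ideal.subset_span ⟨Sum.inl 1, rfl⟩)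
        (Ideal.subset_span ⟨Sum.inl 2, rfl⟩)
        fun i hi => Ideal.subset_span ⟨Sum.inr ⟨i, hi⟩, rfl⟩
  · rw [← range_generators, ← Set.image_univ,
      Set.ncard_image_of_injective _ (injective_of_notMem_span hnot), Set.ncard_univ,
      Nat.card_eq_fintype_card, Fintype.card_sum, Fintype.card_fin, Fintype.card_fin, add_comm]
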